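/- **Setting.** Let $d\ge 1$. Sites $x,y\in\mathbb Z^d$ are neighbours, $x\sim y$, if $x-y\in\{\pm e_1,\dots,\pm e_d\}$. A configuration is $\eta\in\Omega=\{0,1\}^{\mathbb Z^d}$; $x$ is empty if $\eta(x)=0$ and occupied if $\eta(x)=1$. For a permutation $\sigma$ of $\mathbb Z^d$ put $(\sigma\eta)(y)=\eta(\sigma^{-1}(y))$; let $\tau_z$ be the translation $y\mapsto y+z$ and $\eta^{x,y}=(x\,y)\eta$ the configuration with the values at $x$ and $y$ exchanged. A *kinetically constrained lattice gas* on $\mathbb Z^d$ is given by rates $c_{x,y}=c_{y,x}:\Omega\to\mathbb R$, one for each unoriented edge $x\sim y$, such that: (1) $c_{x,y}(\eta)\in\{0\}\cup[1,c_{\max}]$ for some $c_{\max}\ge1$; (2) $c_{x,y}$ depends only on the configuration outside $\{x,y\}$; (3) for each edge there are $\eta,\eta'$ with $c_{x,y}(\eta)\ge1$ and $c_{x,y}(\eta')=0$; (4) $c_{x,y}$ is a decreasing function of $\eta$; (5) $c_{x,y}(\eta)=c_{x+z,y+z}(\tau_z\eta)$ for all $z$; (6) for some $R$, $c_{x,y}$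 depends only on the occupation of $x+[-R,R]^d$. **Noncooperative models.** A deterministic $T$-step move ($T\ge1$) with domain $A\subseteq\Omega$ consists of sites $x_0,\dots,x_{T-1}$ and directions $\varepsilon_0,\dots,\varepsilon_{T-1}\in\{\pm e_1,\dots,\pm e_d\}$ such that for every $\eta\in A$ the sequence $\eta_0=\eta$, $\eta_{t+1}=\eta_t^{x_t,x_t+\varepsilon_t}$ satisfies $c_{x_t,x_t+\varepsilon_t}(\eta_t)\ge1$ for all $t<T$. Its associated permutation is $(x_{T-1},x_{T-1}+\varepsilon_{T-1})\cdots(x_0,x_0+\varepsilon_0)$. A finite set $\mathcal C\subset\mathbb Z^d$ is a *mobile cluster* if there is an integer $l>0$ such that for every $e\in\{\pm e_1,\dots,\pm e_d\}$ and every $x\in\mathbb Z^d$ there exist, with domain $\{\eta: x+\mathcal C\text{ is empty}\}$, * a deterministic move (translation move) whose associated permutation $\sigma$ satisfies $\sigma(x+y)=x+y+e$ for all $y\in\mathcal C$, with all $x_t,\,x_t+\varepsilon_t\in x+[-l,l]^d$; * a deterministic move (exchange move) whose associated permutation is the transposition $(x+le,\;x+(l+1)e)$, with all $x_t,\,x_t+\varepsilon_t\in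 (x+[-l,l]^d)\cup\{x+(l+1)e\}$. The model is *noncooperative* if it has a mobile cluster. **Self-diffusion.** For $q\in(0,1)$ let $\mu$ be the product measure on $\Omega$ under which each site is empty with probability $q$, and let $\mu_0=\mu(\,\cdot\mid\eta(0)=1)$. The self-diffusion matrix $D_s=D_s(q)$ is the symmetric $d\times d$ matrix given, for $u\in\mathbb R^d$, by $$u\cdot D_su=\frac12\inf_f\ \mu_0\Big[\sum_{\substack{\{x,y\}:\,x\sim y\\ x,y\ne0}}c_{x,y}(\eta)\big(f(\eta^{x,y})-f(\eta)\big)^2+\sum_{y\sim0}c_{0,y}(\eta)(1-\eta(y))\big(u\cdot y+f(\tau_{-y}\eta^{0,y})-f(\eta)\big)^2\Big],$$ where the infimum is over all local functions $f:\Omega\to\mathbb R$ (functions of finitely many coordinates) and the first sum is over unoriented edges. **Theorem.** Let $d\ge2$ and consider a noncooperative kinetically constrained lattice gas on $\mathbb Z^d$. For every $q\in(0,1)$ there is exactly one symmetric matrix $D_s(q)$ satisfying the formula above, and it is positive definite. Moreover it decays at most polynomially in $q$: there are a constant $c>0$ and an integer $n\ge0$, depending only on the model (the dimension and the rates) and not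 on $q$, such that $$u\cdot D_s(q)\,u\ \ge\ c\,q^{\,n}\,|u|^2\qquad\text{for all }q\in(0,1)\text{ and all }u\in\mathbb R^d .$$ -/

import Mathlib

open MeasureTheory ProbabilityTheory

namespace KCLG

/-- Sites of the lattice `ℤ^d`. -/
abbrev Site (d : ℕ) : Type := Fin d → ℤ

/-- Configurations `η ∈ {0,1}^{ℤ^d}`: `true` is an occupied site (`η(x) = 1`), `false` an empty
site (`η(x) = 0`). The order is the pointwise one, with `false < true`. -/
abbrev Config (d : ℕ) : Type := Site d → Bool

/-- The standard basis vector `e_α` of `ℤ^d`. -/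
def basisVec {d : ℕ} (α : Fin d) : Site d := Pi.single α 1

/-- The finite set `{±e_1, …, ±e_d}`. -/
def unitVectors (d : ℕ) : Finset (Site d) :=
  Finset.univ.image (fun α : Fin d => basisVec α) ∪
    Finset.univ.image (fun α : Fin d => -basisVec α)

/-- The relation `x ∼ y`: the sites `x` and `y` are nearest neighbours. -/
def Neighbor {d : ℕ} (x y : Site d) : Prop := x - y ∈ unitVectors d

/-- The box `x + [-R,R]^d`. -/
def box {d : ℕ} (x : Site d) (R : ℕ) : Set (Site d) := {z | ∀ i, |z i - x i| ≤ (R : ℤ)}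

/-- The action `(σ η)(y) = η(σ⁻¹ y)` of a permutation of the sites on configurations. -/
def act {d : ℕ} (σ : Equiv.Perm (Site d)) (η : Config d) : Config d := fun y => η (σ⁻¹ y)

/-- The translated configuration `τ_z η`, where `τ_z` is the permutation `y ↦ y + z`. -/
def shift {d : ℕ} (z : Site d) (η : Config d) : Config d := act (Equiv.addRight z) η

/-- The configuration `η^{x,y}`, in which the occupation values at `x` and `y` are exchanged. -/
def exchange {d : ℕ} (x y : Site d) (η : Config d) : Config d := act (Equiv.swap x y) η

/-- A kinetically constrained lattice gas on `ℤ^d`, given by the rates `c_{x,y}(η)` of its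
(unoriented) edges `x ∼ y`. The value of `rate x y` is irrelevant if `x` and `y` are not
neighbours. -/
structure LatticeGas (d : ℕ) where
  /-- The rate `c_{x,y}(η)` at which the occupation values of `x` and `y` are exchanged. -/
  rate : Site d → Site d → Config d → ℝ
  /-- Edges are not oriented. -/
  rate_symm : ∀ x y, Neighbor x y → rate x y = rate y x
  /-- The rates take values in `{0} ∪ [1, c_max]`. -/
  rate_mem : ∃ cmax : ℝ, 1 ≤ cmax ∧
    ∀ x y, Neighbor x y → ∀ η, rate x y η ∈ ({0} : Set ℝ) ∪ Set.Icc 1 cmax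
  /-- The rate of an edge does not depend on the configuration on this edge. -/
  rate_outside : ∀ x y, Neighbor x y → DependsOn (rate x y) ({x, y}ᶜ : Set (Site d))
  /-- The rates are nondegenerate. -/
  rate_nondeg : ∀ x y, Neighbor x y → (∃ η, 1 ≤ rate x y η) ∧ ∃ η, rate x y η = 0
  /-- Emptying sites can only speed up the dynamics. -/
  rate_anti : ∀ x y, Neighbor x y → Antitone (rate x y)
  /-- Homogeneity. -/
  rate_translate : ∀ x y, Neighbor x y → ∀ z η,
    rate x y η = rate (x + z) (y + z) (shift z η)
  /-- Finite range. -/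
  rate_range : ∃ R : ℕ, ∀ x y, Neighbor x y → DependsOn (rate x y) (box x R)

/-! ### Multistep moves and mobile clusters -/

/-- A `T`-step move of the lattice gas `G` on the infinite lattice. -/
structure MultistepMove {d : ℕ} (G : LatticeGas d) (T : ℕ) where
  pos : 0 < T
  /-- The domain of the move. -/
  dom : Set (Config d)
  /-- The configurations `η_0, …, η_T`, as functions of the initial configuration. -/
  conf : Fin (T + 1) → dom → Config d
  /-- The sites `x_0, …, x_{T-1}`. -/
  site : Fin T → dom → Site d
  /-- The directions `e_0, …, e_{T-1}`. -/
  dir : Fin T → dom → Site d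
  dir_mem : ∀ t η, dir t η ∈ unitVectors d
  conf_zero : ∀ η : dom, conf 0 η = η
  conf_succ : ∀ t η,
    conf t.succ η = exchange (site t η) (site t η + dir t η) (conf t.castSucc η)
  /-- The constraint is satisfied at each step. -/
  allowed : ∀ t η, 1 ≤ G.rate (site t η) (site t η + dir t η) (conf t.castSucc η)

namespace MultistepMove

variable {d : ℕ} {G : LatticeGas d} {T : ℕ}

/-- The permutation `(x_{T-1}, x_{T-1}+e_{T-1}) ⋯ (x_0, x_0+e_0)` associated with the move and
with an initial configuration. -/
def assocPerm (M : MultistepMove G T) (η : M.dom) : Equiv.Perm (Site d) :=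
  (List.ofFn fun t => Equiv.swap (M.site t η) (M.site t η + M.dir t η)).reverse.prod

/-- The move is compatible with the permutation `σ`. -/
def CompatibleWith (M : MultistepMove G T) (σ : Equiv.Perm (Site d)) : Prop :=
  ∀ η, M.assocPerm η = σ

/-- The move is deterministic: the sites and directions do not depend on the configuration. -/
def IsDeterministic (M : MultistepMove G T) : Prop :=
  ∀ t η η', M.site t η = M.site t η' ∧ M.dir t η = M.dir t η'

/-- `M` is a translation move in `[-l,l]^d` of the cluster `x + C` in the direction `e`. -/
def IsTranslationMove (M : MultistepMove G T) (C : Finset (Site d)) (l : ℕ) (e x : Site d) :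
    Prop :=
  M.dom = {η | ∀ y ∈ C, η (x + y) = false} ∧
  M.IsDeterministic ∧
  (∃ σ, M.CompatibleWith σ ∧ ∀ y ∈ C, σ (x + y) = x + y + e) ∧
  ∀ t η, M.site t η ∈ box x l ∧ M.site t η + M.dir t η ∈ box x l

/-- `M` is an exchange move in `[-l,l]^d` using the cluster `x + C` in the direction `e`. -/
def IsExchangeMove (M : MultistepMove G T) (C : Finset (Site d)) (l : ℕ) (e x : Site d) :
    Prop :=
  M.dom = {η | ∀ y ∈ C, η (x + y) = false} ∧
  M.IsDeterministic ∧
  M.CompatibleWith (Equiv.swap (x + (l : ℤ) • e) (x + (l : ℤ) • e + e)) ∧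
  ∀ t η, M.site t η ∈ box x l ∪ {x + ((l : ℤ) + 1) • e} ∧
    M.site t η + M.dir t η ∈ box x l ∪ {x + ((l : ℤ) + 1) • e}

end MultistepMove

namespace LatticeGas

variable {d : ℕ}

/-- The finite set `C` is a mobile cluster: for some `l > 0`, translation and exchange moves
exist in all directions. -/
def IsMobileCluster (G : LatticeGas d) (C : Finset (Site d)) : Prop :=
  ∃ l : ℕ, 0 < l ∧ ∀ e ∈ unitVectors d, ∀ x : Site d,
    (∃ (T : ℕ) (M : MultistepMove G T), M.IsTranslationMove C l e x) ∧
    ∃ (T : ℕ) (M : MultistepMove G T), M.IsExchangeMove C l e x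

/-- The lattice gas is noncooperative: there exists a mobile cluster. -/
def Noncooperative (G : LatticeGas d) : Prop := ∃ C : Finset (Site d), G.IsMobileCluster C

end LatticeGas

/-! ### Equilibrium measure and self-diffusion -/

/-- The equilibrium measure `μ = μ_q`: the sites are independent, and each of them is empty with
probability `q` and occupied with probability `1 - q`. -/
noncomputable def equilibrium (d : ℕ) (q : unitInterval) : Measure (Config d) :=
  Measure.infinitePi fun _ : Site d => bernoulliMeasure false true q

/-- The measure `μ_0`: the equilibrium measure conditioned on having a particle (the tracer) at
the origin. -/
noncomputable def tracerMeasure (d : ℕ) (q : unitInterval) : Measure (Config d) :=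
  ProbabilityTheory.cond (equilibrium d q) {η | η 0 = true}

/-- Local functions: functions of the occupation of finitely many sites. -/
def IsLocal {d : ℕ} (f : Config d → ℝ) : Prop := ∃ s : Finset (Site d), DependsOn f s

/-- The scalar product `u · y` of `u ∈ ℝ^d` with a site `y ∈ ℤ^d`. -/
def siteDot {d : ℕ} (u : Fin d → ℝ) (y : Site d) : ℝ := ∑ i, u i * (y i : ℝ)

namespace LatticeGas

variable {d : ℕ}

/-- The term of the edge `{x, y}`, `x, y ≠ 0`: `c_{x,y} (f(η^{x,y}) - f(η))²`. -/
def edgeTerm (G : LatticeGas d) (f : Config d → ℝ) (x y : Site d) (η : Config d) : ℝ :=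
  G.rate x y η * (f (exchange x y η) - f η) ^ 2

/-- The term of a jump of the tracer from `0` to its neighbour `y`:
`c_{0,y} (1 - η(y)) (u·y + f(τ_{-y} η^{0,y}) - f(η))²`. -/
def jumpTerm (G : LatticeGas d) (u : Fin d → ℝ) (f : Config d → ℝ) (y : Site d)
    (η : Config d) : ℝ :=
  G.rate 0 y η * (if η y = true then 0 else 1) *
    (siteDot u y + f (shift (-y) (exchange 0 y η)) - f η) ^ 2

/-- The functional minimized in the variational formula. Each unoriented edge is counted once,
as `{x, x + e_α}`. For a local function `f` all but finitely many terms of the infinite sum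
vanish identically. -/
noncomputable def tracerFunctional (G : LatticeGas d) (q : unitInterval) (u : Fin d → ℝ)
    (f : Config d → ℝ) : ℝ :=
  ∫ η, ((∑' x : Site d, ∑ α : Fin d,
      if x ≠ 0 ∧ x + basisVec α ≠ 0 then G.edgeTerm f x (x + basisVec α) η else 0) +
    ∑ y ∈ unitVectors d, G.jumpTerm u f y η) ∂tracerMeasure d q

/-- The right-hand side of the variational formula for `u · D_s u`: half the infimum of the
functional over all local functions. -/
noncomputable def selfDiffusionForm (G : LatticeGas d) (q : unitInterval) (u : Fin d → ℝ) : ℝ :=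
  (1 / 2) * ⨅ f : {f : Config d → ℝ // IsLocal f}, G.tracerFunctional q u f

/-- `D` is the self-diffusion matrix of `G` at density `q` of empty sites: the symmetric matrix
given by the variational formula. -/
def IsSelfDiffusionMatrix (G : LatticeGas d) (q : unitInterval)
    (D : Matrix (Fin d) (Fin d) ℝ) : Prop :=
  D.IsSymm ∧ ∀ u : Fin d → ℝ, u ⬝ᵥ D.mulVec u = G.selfDiffusionForm q u

end LatticeGas

end KCLG

/-! The lower bound rests on one closed route for the environment seen from the tracer. Suppose
that, whenever a finite set `E` not containing `0` is empty, a fixed sequence of allowed exchanges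
with permutation `σ` moves the tracer from `0` to a unit vector `e` and carries `E` to `E + e`. Then
`π = τ_{-e} σ` fixes `0` and maps `E` onto itself, so it preserves `μ_0` restricted to the event
that `E` is empty, and `f ∘ π - f` has mean zero there. Hence, with `t = u · e`, the integral of `(t
+ f ∘ π - f)²` over this event is at least `q^|E| t²`, for every local `f` (`TracerPath.sq_le`).
Conversely, splitting `t + f ∘ π - f` into the increments along the route and changing variables in
each of them bounds this integral by a constant times the functional; the constant depends only on
the route (`TracerPath.energy_le`).

The route (`HasMoves.exists_tracerPath`) uses two clusters. The sites of a box `B` next to the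
tracer are empty, so the cluster at its centre can perform the exchange move that takes the tracer
from `0` to `e`, even though the tracer lies in the region of the move. A second, distant cluster
then rearranges the vacancies into `B + e` without moving the tracer, and is finally translated by
`e` itself. The rearrangement is possible because the distant cluster can transpose any two sites
other than the tracer's (`HasMoves.performable_swap`): it walks to the sites, exchanges them and
retraces its way. Here `d ≥ 2` enters, since complements of boxes are then connected.

Existence and uniqueness of the matrix are independent of the kinetic constraint's details: the
functional is jointly quadratic in `(u, f)`, so its infimum over `f` satisfies the parallelogram law
and is a quadratic form in `u`. -/

namespace KCLG

/-! ### Paths of configurations with a tracer -/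

section Paths

variable {d : ℕ}

lemma act_one (η : Config d) : act 1 η = η := rfl

lemma act_mul (σ ρ : Equiv.Perm (Site d)) (η : Config d) : act (σ * ρ) η = act σ (act ρ η) := by
  funext y
  simp [act, mul_inv_rev]

lemma act_apply (σ : Equiv.Perm (Site d)) (η : Config d) (z : Site d) :
    act σ η (σ z) = η z := by
  simp [act]

/-- The configurations in which all sites of `E` are empty. -/
def emptyOn (E : Set (Site d)) : Set (Config d) := {η | ∀ z ∈ E, η z = false}

lemma emptyOn_anti {E E' : Set (Site d)} (h : E ⊆ E') : emptyOn E' ⊆ emptyOn E :=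
  fun _ hη z hz => hη z (h hz)

lemma act_mem_emptyOn {E : Set (Site d)} {σ : Equiv.Perm (Site d)} {η : Config d} :
    act σ η ∈ emptyOn (σ '' E) ↔ η ∈ emptyOn E := by
  simp only [emptyOn, Set.mem_ofPred_eq, Set.forall_mem_image, act_apply]

/-- Permutations that arise from a sequence of exchanges, started from a configuration in which
`E` is empty and the tracer is at `p`: all exchanges are allowed, and the tracer is exchanged
only with empty sites. -/
inductive TracerPath (G : LatticeGas d) (E : Set (Site d)) (p : Site d) :
    Equiv.Perm (Site d) → Prop
  | refl : TracerPath G E p 1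
  | step {σ : Equiv.Perm (Site d)} {x y : Site d} (h : TracerPath G E p σ) (hxy : Neighbor x y)
      (hrate : ∀ η ∈ emptyOn E, 1 ≤ G.rate x y (act σ η))
      (hempty : σ p = x ∨ σ p = y → ∀ η ∈ emptyOn E, act σ η (Equiv.swap x y (σ p)) = false) :
      TracerPath G E p (Equiv.swap x y * σ)

namespace TracerPath

variable {G : LatticeGas d} {E E' : Set (Site d)} {p : Site d} {σ ρ : Equiv.Perm (Site d)}

/-- The second path may start because every site of `E'` holds, after `σ`, the value that was
initially at a site of `E`. -/
lemma comp (h : TracerPath G E p σ) (h' : TracerPath G E' (σ p) ρ)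
    (hE : ∀ z ∈ E', σ⁻¹ z ∈ E) : TracerPath G E p (ρ * σ) := by
  have hdom : ∀ η ∈ emptyOn E, act σ η ∈ emptyOn E' := fun η hη z hz => hη _ (hE z hz)
  induction h' with
  | refl => simpa using h
  | step _ hxy hrate hempty ih =>
    rw [mul_assoc]
    refine ih.step hxy (fun η hη => ?_) (fun hp η hη => ?_)
    · rw [act_mul]; exact hrate _ (hdom η hη)
    · rw [act_mul]; exact hempty hp _ (hdom η hη)

/-- Exchanges are reversible: the rate of an edge ignores the values on that edge, so an exchange
that was allowed may be undone at once. -/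
lemma inverse (h : TracerPath G E p σ) : TracerPath G (σ '' E) (σ p) σ⁻¹ := by
  induction h with
  | refl => simpa using TracerPath.refl
  | @step σ x y h hxy hrate hempty ih =>
    have key : ∀ ζ ∈ emptyOn ((Equiv.swap x y * σ : Equiv.Perm (Site d)) '' E),
        ∃ η ∈ emptyOn E, ζ = act (Equiv.swap x y) (act σ η) := by
      intro ζ hζ
      refine ⟨act (Equiv.swap x y * σ)⁻¹ ζ, ?_, ?_⟩
      · rw [← act_mem_emptyOn (σ := Equiv.swap x y * σ), ← act_mul]
        simpa [act_one] using hζ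
      · rw [← act_mul, ← act_mul]
        simp [mul_assoc, act_one]
    have h1 : TracerPath G ((Equiv.swap x y * σ : Equiv.Perm (Site d)) '' E)
        ((Equiv.swap x y * σ) p) (Equiv.swap x y * 1) := by
      refine TracerPath.refl.step hxy (fun ζ hζ => ?_) (fun hp ζ hζ => ?_)
      · obtain ⟨η, hη, rfl⟩ := key ζ hζ
        rw [act_one]
        refine (hrate η hη).trans_eq (G.rate_outside x y hxy fun z hz => ?_)
        have hz' : z ≠ x ∧ z ≠ y := by simpa using hz
        conv_rhs => rw [← Equiv.swap_apply_of_ne_of_ne hz'.1 hz'.2, act_apply]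
      · obtain ⟨η, hη, rfl⟩ := key ζ hζ
        have hp' : σ p = x ∨ σ p = y := by
          rcases hp with hp | hp
          · right
            simpa [Equiv.swap_apply_eq_iff] using hp
          · left
            simpa [Equiv.swap_apply_eq_iff] using hp
        rw [act_one, Equiv.Perm.one_apply, act_apply]
        exact hempty hp' η hη
    have h2 := h1.comp (E' := σ '' E) (ρ := σ⁻¹) (by simpa using ih) (by
      rintro _ ⟨z, hz, rfl⟩
      exact ⟨z, hz, by simp⟩)
    simpa [mul_inv_rev] using h2

end TracerPath

/-- A deterministic move in the region `Z` is a path of the tracer, if the tracer is not in `Z`,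
or if all other sites of `Z` are empty. -/
lemma MultistepMove.tracerPath {G : LatticeGas d} {T : ℕ} (M : MultistepMove G T)
    (hdet : M.IsDeterministic) {D Z E : Set (Site d)} (hdom : M.dom = emptyOn D) (hDE : D ⊆ E)
    {σ : Equiv.Perm (Site d)} (hσ : M.CompatibleWith σ)
    (hZ : ∀ t η, M.site t η ∈ Z ∧ M.site t η + M.dir t η ∈ Z) :
    (∀ p, (p ∈ Z → ∀ z ∈ Z, z ≠ p → z ∈ E) → TracerPath G E p σ) ∧ ∀ z ∉ Z, σ z = z := by
  -- The completely empty configuration lies in the domain. By determinism, its sequence of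
  -- exchanges is that of every configuration in the domain.
  obtain ⟨η₀⟩ : Nonempty M.dom := ⟨⟨fun _ => false, by rw [hdom]; exact fun _ _ => rfl⟩⟩
  set L := List.ofFn fun t => Equiv.swap (M.site t η₀) (M.site t η₀ + M.dir t η₀) with hL
  have key : ∀ k (hk : k < T + 1),
      (∀ p, (p ∈ Z → ∀ z ∈ Z, z ≠ p → z ∈ E) → TracerPath G E p (L.take k).reverse.prod) ∧
      (∀ z ∉ Z, (L.take k).reverse.prod z = z) ∧
      ∀ η, M.conf ⟨k, hk⟩ η = act (L.take k).reverse.prod η := by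
    intro k
    induction k with
    | zero =>
      intro hk
      refine ⟨fun p _ => by simpa using TracerPath.refl, by simp, fun η => ?_⟩
      simpa [act_one] using M.conf_zero η
    | succ k ih =>
      intro hk
      have hkT : k < T := by omega
      obtain ⟨ih1, ih2, ih3⟩ := ih (by omega)
      set x := M.site ⟨k, hkT⟩ η₀
      set y := x + M.dir ⟨k, hkT⟩ η₀ with hy
      have hprod : (L.take (k + 1)).reverse.prod
          = Equiv.swap x y * (L.take k).reverse.prod := by
        rw [List.take_add_one]
        simp [hL, hkT, x, y]
      rw [hprod]
      set ρ := (L.take k).reverse.prod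
      have hsite : ∀ η, M.site ⟨k, hkT⟩ η = x ∧ M.site ⟨k, hkT⟩ η + M.dir ⟨k, hkT⟩ η = y := by
        intro η
        obtain ⟨h1, h2⟩ := hdet ⟨k, hkT⟩ η η₀
        exact ⟨h1, by rw [h1, h2]⟩
      obtain ⟨hxZ, hyZ⟩ : x ∈ Z ∧ y ∈ Z := hZ ⟨k, hkT⟩ η₀
      have hdir := M.dir_mem ⟨k, hkT⟩ η₀
      have hnb : Neighbor x y := by
        have : x - y = -M.dir ⟨k, hkT⟩ η₀ := by rw [hy]; abel
        rw [Neighbor, this]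
        simp only [unitVectors, Finset.mem_union, Finset.mem_image, Finset.mem_univ, true_and]
          at hdir ⊢
        rcases hdir with ⟨α, h⟩ | ⟨α, h⟩
        · right; exact ⟨α, by rw [h]⟩
        · left; exact ⟨α, by rw [← h, neg_neg]⟩
      refine ⟨fun p hp => (ih1 p hp).step hnb (fun η hη => ?_) (fun hpx η hη => ?_),
        fun z hz => ?_, fun η => ?_⟩
      · have hη' : η ∈ M.dom := by rw [hdom]; exact emptyOn_anti hDE hη
        have := M.allowed ⟨k, hkT⟩ ⟨η, hη'⟩
        rw [(hsite _).2, (hsite _).1] at this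
        rwa [← ih3 ⟨η, hη'⟩]
      · have hρp : ρ p ∈ Z := by rcases hpx with h | h <;> rw [h] <;> assumption
        have hpZ : p ∈ Z := by
          by_contra h
          rw [ih2 p h] at hρp
          exact h hρp
        have hne : Equiv.swap x y (ρ p) ≠ ρ p := by
          have hxy : x ≠ y := by
            rintro h
            rw [← h, Neighbor, sub_self] at hnb
            simp [unitVectors, basisVec] at hnb
          rcases hpx with h | h <;> simp [h, hxy, hxy.symm]
        have hmem : Equiv.swap x y (ρ p) ∈ Z := by
          rcases hpx with h | h <;> simpa [h]
        -- The value met by the tracer started at some `z ≠ p`. Since `ρ` fixes the complement of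
        -- `Z`, this `z` lies in `Z`, hence in `E`, and the value is empty.
        obtain ⟨z, hz⟩ := ρ.surjective (Equiv.swap x y (ρ p))
        rw [← hz, act_apply]
        refine hη z (hp hpZ z ?_ ?_)
        · by_contra h
          rw [← hz, ih2 z h] at hmem
          exact h hmem
        · rintro rfl
          exact hne hz.symm
      · rw [Equiv.Perm.mul_apply, ih2 z hz, Equiv.swap_apply_of_ne_of_ne]
        · rintro rfl; exact hz hxZ
        · rintro rfl; exact hz hyZ
      · have := M.conf_succ ⟨k, hkT⟩ η
        rw [(hsite _).2, (hsite _).1] at this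
        rw [act_mul]
        have h3 := ih3 η
        rw [← h3]
        exact this
  have hfin : (L.take T).reverse.prod = σ := by
    rw [← hσ η₀, List.take_of_length_le (by simp [hL])]
    rfl
  obtain ⟨h1, h2, -⟩ := key T (by omega)
  rw [hfin] at h1 h2
  exact ⟨h1, h2⟩

end Paths

/-! ### Connectedness of the complement of a box -/

section Connectivity

variable {d : ℕ}

lemma mem_unitVectors {e : Site d} :
    e ∈ unitVectors d ↔ ∃ α : Fin d, e = basisVec α ∨ e = -basisVec α := by
  simp only [unitVectors, Finset.mem_union, Finset.mem_image, Finset.mem_univ, true_and,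
    ← exists_or, eq_comm]

lemma neg_mem_unitVectors {e : Site d} (he : e ∈ unitVectors d) : -e ∈ unitVectors d := by
  obtain ⟨α, rfl | rfl⟩ := mem_unitVectors.1 he
  · exact mem_unitVectors.2 ⟨α, .inr rfl⟩
  · exact mem_unitVectors.2 ⟨α, .inl (neg_neg _)⟩

/-- The site `x` is outside of the box of radius `R` around `p`. -/
def Outside (p : Site d) (R : ℕ) (x : Site d) : Prop := ∃ i, (R : ℤ) < |x i - p i|

/-- In dimension at least two, the complement of a box is connected. -/
lemma outside_connected (hd : 2 ≤ d) {p : Site d} {R : ℕ} {Q : Site d → Site d → Prop}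
    (hrefl : ∀ x, Q x x) (htrans : ∀ x y z, Q x y → Q y z → Q x z)
    (hstep : ∀ x, ∀ e ∈ unitVectors d, Outside p R x → Outside p R (x + e) → Q x (x + e))
    {x y : Site d} (hx : Outside p R x) (hy : Outside p R y) : Q x y := by
  -- While coordinate `j` witnesses that the site is outside the box, any other coordinate may be
  -- changed freely.
  have line : ∀ (x : Site d) (i j : Fin d), i ≠ j → (R : ℤ) < |x j - p j| → ∀ s : ℤ,
      (s = 1 ∨ s = -1) → ∀ n : ℕ, Q x (x + ((n : ℤ) * s) • basisVec i) := by
    intro x i j hij hj s hs n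
    induction n with
    | zero => simpa using hrefl x
    | succ n ih =>
      have hout : ∀ m : ℤ, Outside p R (x + m • basisVec i) := fun m =>
        ⟨j, by simpa [basisVec, Pi.single_eq_of_ne hij.symm] using hj⟩
      have h1 : x + (((n + 1 : ℕ) : ℤ) * s) • basisVec i
          = x + ((n : ℤ) * s) • basisVec i + s • basisVec i := by
        push_cast
        rw [add_mul, one_mul, add_smul, add_assoc]
      have h2 := hstep (x + ((n : ℤ) * s) • basisVec i) (s • basisVec i)
        (mem_unitVectors.2 ⟨i, by rcases hs with rfl | rfl <;> simp⟩) (hout _)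
        (by rw [← h1]; exact hout _)
      rw [h1]
      exact htrans _ _ _ ih h2
  have upd : ∀ (x : Site d) (i j : Fin d), i ≠ j → (R : ℤ) < |x j - p j| → ∀ v : ℤ,
      Q x (Function.update x i v) := by
    intro x i j hij hj v
    have h1 : Function.update x i v = x + (v - x i) • basisVec i := by
      funext k
      by_cases hk : k = i
      · subst hk; simp [basisVec]
      · simp [basisVec, hk]
    rw [h1]
    rcases Int.natAbs_eq (v - x i) with h | h
    · rw [h]; simpa using line x i j hij hj 1 (.inl rfl) (v - x i).natAbs
    · rw [h]; simpa using line x i j hij hj (-1) (.inr rfl) (v - x i).natAbs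
  have face : ∀ (x y : Site d) (j : Fin d), (R : ℤ) < |x j - p j| → y j = x j → Q x y := by
    intro x y j hj hyj
    have : ∀ s : Finset (Fin d), Q x (fun k => if k ∈ s then y k else x k) := by
      intro s
      induction s using Finset.induction_on with
      | empty => simpa using hrefl x
      | insert k s hk ih =>
        have h1 : (fun i => if i ∈ insert k s then y i else x i)
            = Function.update (fun i => if i ∈ s then y i else x i) k (y k) := by
          funext i
          by_cases hi : i = k
          · subst hi; simp
          · simp [hi]
        rw [h1]
        refine htrans _ _ _ ih ?_
        by_cases hkj : k = j
        · subst hkj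
          have : Function.update (fun i => if i ∈ s then y i else x i) k (y k)
              = fun i => if i ∈ s then y i else x i := by
            rw [Function.update_eq_self_iff]
            simp [hk, hyj]
          rw [this]
          exact hrefl _
        · refine upd _ k j hkj ?_ _
          simpa [hyj] using hj
    simpa using this Finset.univ
  obtain ⟨i, hi⟩ := hx
  obtain ⟨j, hj⟩ := hy
  by_cases hij : i = j
  · subst hij
    obtain ⟨k, hk⟩ : ∃ k : Fin d, k ≠ i := by
      have : Nontrivial (Fin d) := Fin.nontrivial_iff_two_le.2 hd
      exact exists_ne i
    -- `x` and `y` may lie on opposite sides of the box. Pushing a second coordinate `k` out to `p k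
    -- + R + 1` lets coordinate `i` cross over.
    refine htrans _ _ _ (upd x k i hk hi (p k + R + 1)) ?_
    refine htrans _ _ _ (upd _ i k hk.symm ?_ (y i)) (face _ y i ?_ ?_)
    · rw [Function.update_self, add_assoc, add_sub_cancel_left, abs_of_nonneg (by positivity)]
      omega
    · simpa using hj
    · simp
  · refine htrans _ _ _ (upd x j i (Ne.symm hij) hi (y j)) (face _ y j ?_ ?_)
    · simpa using hj
    · simp

end Connectivity

/-! ### Transport and use of mobile clusters -/

section Clusters

variable {d : ℕ} {G : LatticeGas d} {C : Finset (Site d)} {l : ℕ}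

/-- The moves of a mobile cluster in boxes of size `l`. -/
def HasMoves (G : LatticeGas d) (C : Finset (Site d)) (l : ℕ) : Prop :=
  ∀ e ∈ unitVectors d, ∀ x : Site d,
    (∃ (T : ℕ) (M : MultistepMove G T), M.IsTranslationMove C l e x) ∧
    ∃ (T : ℕ) (M : MultistepMove G T), M.IsExchangeMove C l e x

/-- The translated cluster `x + C`. -/
def cluster (C : Finset (Site d)) (x : Site d) : Set (Site d) :=
  (fun y => x + y) '' (C : Set (Site d))

lemma emptyOn_cluster (x : Site d) :
    emptyOn (cluster C x) = {η | ∀ y ∈ C, η (x + y) = false} := by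
  simp only [emptyOn, cluster, Set.forall_mem_image, Finset.mem_coe]

lemma HasMoves.translation (h : HasMoves G C l) {e : Site d} (he : e ∈ unitVectors d)
    (x : Site d) : ∃ σ : Equiv.Perm (Site d),
      (∀ p ∉ box x l, TracerPath G (cluster C x) p σ) ∧ (∀ y ∈ C, σ (x + y) = x + y + e) ∧
      ∀ z ∉ box x l, σ z = z := by
  obtain ⟨T, M, hdom, hdet, ⟨σ, hσ, hC⟩, hbox⟩ := (h e he x).1
  obtain ⟨h1, h2⟩ := M.tracerPath hdet (hdom.trans (emptyOn_cluster x).symm) subset_rfl hσ hbox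
  exact ⟨σ, fun p hp => h1 p fun h => absurd h hp, hC, h2⟩

lemma HasMoves.exchange (h : HasMoves G C l) {e : Site d} (he : e ∈ unitVectors d)
    (x : Site d) {E : Set (Site d)} (hE : cluster C x ⊆ E) {p : Site d}
    (hp : p ∈ box x l ∪ {x + ((l : ℤ) + 1) • e} →
      ∀ z ∈ box x l ∪ {x + ((l : ℤ) + 1) • e}, z ≠ p → z ∈ E) :
    TracerPath G E p (Equiv.swap (x + (l : ℤ) • e) (x + (l : ℤ) • e + e)) := by
  obtain ⟨T, M, hdom, hdet, hσ, hbox⟩ := (h e he x).2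
  exact (M.tracerPath hdet (hdom.trans (emptyOn_cluster x).symm) hE hσ hbox).1 p hp

/-- A translation move fixes the sites outside the box but displaces each site of the cluster by `e
≠ 0`. -/
lemma HasMoves.cluster_subset_box (hd : 2 ≤ d) (h : HasMoves G C l) (x : Site d) :
    cluster C x ⊆ box x l := by
  rintro _ ⟨y, hy, rfl⟩
  have he : basisVec (⟨0, by omega⟩ : Fin d) ∈ unitVectors d := mem_unitVectors.2 ⟨_, .inl rfl⟩
  obtain ⟨σ, -, h1, h2⟩ := h.translation he x
  by_contra hbox
  have h3 := (h1 y hy).symm.trans (h2 _ hbox)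
  simp [basisVec] at h3

/-- There is a path that carries the cluster from `x` to `x'` and does not touch `Z`. -/
def Carries (G : LatticeGas d) (C : Finset (Site d)) (Z : Set (Site d)) (x x' : Site d) : Prop :=
  ∃ ρ : Equiv.Perm (Site d), (∀ p ∈ Z, TracerPath G (cluster C x) p ρ) ∧
    (∀ y ∈ C, ρ (x + y) = x' + y) ∧ ∀ z ∈ Z, ρ z = z

lemma Carries.refl (Z : Set (Site d)) (x : Site d) : Carries G C Z x x :=
  ⟨1, fun _ _ => .refl, fun _ _ => rfl, fun _ _ => rfl⟩

lemma Carries.trans {Z : Set (Site d)} {x y z : Site d} (h : Carries G C Z x y)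
    (h' : Carries G C Z y z) : Carries G C Z x z := by
  obtain ⟨ρ, h1, h2, h3⟩ := h
  obtain ⟨σ, k1, k2, k3⟩ := h'
  refine ⟨σ * ρ, fun p hp => (h1 p hp).comp (E' := cluster C y) ?_ ?_, fun w hw => ?_,
    fun w hw => ?_⟩
  · rw [h3 p hp]
    exact k1 p hp
  · rintro _ ⟨w, hw, rfl⟩
    exact ⟨w, hw, by rw [Equiv.Perm.eq_inv_iff_eq, h2 w hw]⟩
  · rw [Equiv.Perm.mul_apply, h2 w hw, k2 w hw]
  · rw [Equiv.Perm.mul_apply, h3 w hw, k3 w hw]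

lemma HasMoves.carries_step (h : HasMoves G C l) {Z : Set (Site d)} {e : Site d}
    (he : e ∈ unitVectors d) {x : Site d} (hZ : ∀ z ∈ Z, z ∉ box x l) :
    Carries G C Z x (x + e) := by
  obtain ⟨σ, h1, h2, h3⟩ := h.translation he x
  exact ⟨σ, fun p hp => h1 p (hZ p hp), fun y hy => by rw [h2 y hy]; abel,
    fun z hz => h3 z (hZ z hz)⟩

/-- A cluster that is far away can perform the permutation `π` in the presence of a tracer at `p`,
which does not move. -/
def Performable (G : LatticeGas d) (C : Finset (Site d)) (p : Site d) (π : Equiv.Perm (Site d)) :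
    Prop :=
  ∃ K : ℕ, ∀ x, Outside 0 K x →
    TracerPath G (cluster C x) p π ∧ (∀ y ∈ C, π (x + y) = x + y) ∧ π p = p

lemma Outside.mono {p x : Site d} {R R' : ℕ} (h : R ≤ R') (hx : Outside p R' x) :
    Outside p R x := by
  obtain ⟨i, hi⟩ := hx
  exact ⟨i, lt_of_le_of_lt (by exact_mod_cast h) hi⟩

lemma Outside.notMem_box {x z : Site d} {K l : ℕ} (hx : Outside 0 (K + l) x) (hz : z ∈ box 0 K) :
    z ∉ box x l := by
  obtain ⟨i, hi⟩ := hx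
  intro h
  have h1 := h i
  have h2 := hz i
  simp only [Pi.zero_apply, sub_zero] at hi h2
  push_cast at hi
  grind

lemma exists_mem_box (S : Finset (Site d)) : ∃ K : ℕ, ∀ z ∈ S, z ∈ box 0 K := by
  refine ⟨∑ z ∈ S, ∑ i, (z i).natAbs, fun z hz i => ?_⟩
  have h1 : (z i).natAbs ≤ ∑ i, (z i).natAbs :=
    Finset.single_le_sum (f := fun i => (z i).natAbs) (fun _ _ => Nat.zero_le _)
      (Finset.mem_univ i)
  have h2 : ∑ i, (z i).natAbs ≤ ∑ z ∈ S, ∑ i, (z i).natAbs :=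
    Finset.single_le_sum (f := fun z : Site d => ∑ i, (z i).natAbs) (fun _ _ => Nat.zero_le _) hz
  simp only [Pi.zero_apply, sub_zero]
  rw [Int.abs_eq_natAbs]
  exact_mod_cast h1.trans h2

lemma Performable.one (p : Site d) : Performable G C p 1 :=
  ⟨0, fun _ _ => ⟨.refl, fun _ _ => rfl, rfl⟩⟩

lemma Performable.mul {p : Site d} {π ρ : Equiv.Perm (Site d)} (h : Performable G C p π)
    (h' : Performable G C p ρ) : Performable G C p (π * ρ) := by
  obtain ⟨K, hK⟩ := h
  obtain ⟨K', hK'⟩ := h'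
  refine ⟨max K K', fun x hx => ?_⟩
  obtain ⟨h1, h2, h3⟩ := hK x (hx.mono (le_max_left _ _))
  obtain ⟨k1, k2, k3⟩ := hK' x (hx.mono (le_max_right _ _))
  refine ⟨k1.comp (E' := cluster C x) (by rwa [k3]) ?_, fun y hy => ?_, ?_⟩
  · rintro _ ⟨y, hy, rfl⟩
    exact ⟨y, hy, by rw [Equiv.Perm.eq_inv_iff_eq, k2 y hy]⟩
  · rw [Equiv.Perm.mul_apply, k2 y hy, h2 y hy]
  · rw [Equiv.Perm.mul_apply, k3, h3]

/-- With `e = s • basisVec α`, the tracer is strictly ahead of `a` in direction `e`. The cluster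
approaches `a` from behind, along a ray whose boxes avoid the tracer, performs the exchange move,
and retraces its way. The approach `ρ` fixes `a` and `a + e`, so conjugation by it leaves the
transposition unchanged and undoes all other disturbance. -/
lemma HasMoves.performable_swap_aux (hd : 2 ≤ d) (h : HasMoves G C l) {p a : Site d} {α : Fin d}
    {s : ℤ} (hs : s = 1 ∨ s = -1) (hpa : s * a α < s * p α) (hp : p ≠ a + s • basisVec α) :
    Performable G C p (Equiv.swap a (a + s • basisVec α)) := by
  set e : Site d := s • basisVec α with he_def
  have he : e ∈ unitVectors d :=
    mem_unitVectors.2 ⟨α, by rcases hs with rfl | rfl <;> simp [he_def]⟩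
  have heα : e α = s := by simp [he_def, basisVec]
  have hss : s * s = 1 := by rcases hs with rfl | rfl <;> rfl
  set Z : Set (Site d) := {p, a, a + e} with hZ
  set x : Site d := a - (l : ℤ) • e with hx
  -- The box around `x - n • e` lies in the half-space `s * z α ≤ s * a α - n`. For `n ≥ 1` it
  -- misses all of `Z`; for `n = 0` it still misses `p`.
  have hbox : ∀ (n : ℕ) (z : Site d), s * a α < s * z α + n → z ∉ box (x - (n : ℤ) • e) l := by
    intro n z hz hmem
    have h1 := hmem α
    have h2 : (x - (n : ℤ) • e) α = a α - l * s - n * s := by simp [hx, heα]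
    rw [h2] at h1
    rcases hs with rfl | rfl <;> grind
  have hray : ∀ n : ℕ, Carries G C Z (x - (n : ℤ) • e) x := by
    intro n
    induction n with
    | zero => simpa using Carries.refl Z x
    | succ n ih =>
      have hstep : Carries G C Z (x - ((n + 1 : ℕ) : ℤ) • e) (x - ((n + 1 : ℕ) : ℤ) • e + e) := by
        refine h.carries_step he fun z hz => hbox _ z ?_
        push_cast
        rcases hz with rfl | rfl | rfl
        · linarith
        · linarith
        · rw [Pi.add_apply, heα, mul_add, hss]
          linarith
      have h1 : x - ((n + 1 : ℕ) : ℤ) • e + e = x - (n : ℤ) • e := by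
        push_cast
        rw [add_smul, one_smul]
        abel
      rw [h1] at hstep
      exact hstep.trans ih
  obtain ⟨K, hK⟩ := exists_mem_box ({p, a, a + e} : Finset (Site d))
  have hKZ : ∀ z ∈ Z, z ∈ box 0 K := fun z hz => hK z (by simpa [hZ] using hz)
  refine ⟨K + l, fun X hX => ?_⟩
  obtain ⟨ρ, h1, h2, h3⟩ : Carries G C Z X x := by
    -- The number of steps is chosen so that the start of the ray lies outside the box of radius `K
    -- + l`, where the cluster can walk freely without touching `Z`.
    refine Carries.trans ?_ (hray (s * x α + (K + l : ℕ) + 1).toNat)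
    refine outside_connected hd (Carries.refl Z) (fun _ _ _ => Carries.trans) ?_ hX ?_
    · exact fun x e he hx _ => h.carries_step he fun z hz => hx.notMem_box (hKZ z hz)
    · refine ⟨α, ?_⟩
      have h2 : (x - ((s * x α + (K + l : ℕ) + 1).toNat : ℤ) • e) α
          = x α - ((s * x α + (K + l : ℕ) + 1).toNat : ℤ) * s := by simp [heα]
      rw [h2, Pi.zero_apply, sub_zero]
      have h3 := Int.self_le_toNat (s * x α + (K + l : ℕ) + 1)
      rcases hs with rfl | rfl <;> grind
  have hpZ : p ∈ Z := by simp [hZ]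
  have haZ : a ∈ Z := by simp [hZ]
  have hbZ : a + e ∈ Z := by simp [hZ]
  have hp1 := h1 p hpZ
  have hpa' : p ≠ a := by rintro rfl; exact lt_irrefl _ hpa
  have hfar : ∀ y ∈ C, ∀ z ∈ Z, X + y ≠ z := by
    rintro y hy z hz rfl
    exact hX.notMem_box (hKZ _ hz) (h.cluster_subset_box hd X ⟨y, hy, rfl⟩)
  -- The cluster at `x` cannot occupy `a` or `a + e`: these are fixed by `ρ`, and its sites are
  -- images of sites far away. So the exchange leaves it intact for the return.
  have hswap : ∀ y ∈ C, Equiv.swap a (a + e) (x + y) = x + y := by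
    intro y hy
    refine Equiv.swap_apply_of_ne_of_ne ?_ ?_
    · intro hya
      refine hfar y hy a haZ (ρ.injective ?_)
      rw [h2 y hy, h3 a haZ, hya]
    · intro hya
      refine hfar y hy _ hbZ (ρ.injective ?_)
      rw [h2 y hy, h3 _ hbZ, hya]
  have hex : TracerPath G (cluster C x) p (Equiv.swap a (a + e)) := by
    have hxa : x + (l : ℤ) • e = a := by simp [hx]
    have hxb : x + ((l : ℤ) + 1) • e = a + e := by rw [add_smul, one_smul, ← add_assoc, hxa]
    have := h.exchange he x (subset_refl (cluster C x)) (p := p) (by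
      rw [hxb]
      rintro (hpx | hpx)
      · exact absurd (by simpa using hpx) (hbox 0 p (by simpa using hpa))
      · exact absurd hpx hp)
    rwa [hxa] at this
  have hback := hp1.inverse
  rw [h3 p hpZ] at hback
  have h12 : TracerPath G (cluster C X) p (Equiv.swap a (a + e) * ρ) := by
    refine hp1.comp (E' := cluster C x) (by rwa [h3 p hpZ]) ?_
    rintro _ ⟨y, hy, rfl⟩
    exact ⟨y, hy, by rw [Equiv.Perm.eq_inv_iff_eq, h2 y hy]⟩
  have h123 : TracerPath G (cluster C X) p (ρ⁻¹ * (Equiv.swap a (a + e) * ρ)) := by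
    refine h12.comp (E' := ρ '' cluster C X) ?_ ?_
    · rwa [Equiv.Perm.mul_apply, h3 p hpZ, Equiv.swap_apply_of_ne_of_ne hpa' hp]
    · rintro _ ⟨_, ⟨y, hy, rfl⟩, rfl⟩
      refine ⟨y, hy, ?_⟩
      rw [Equiv.Perm.eq_inv_iff_eq, Equiv.Perm.mul_apply, h2 y hy, hswap y hy]
  have hconj : ρ⁻¹ * (Equiv.swap a (a + e) * ρ) = Equiv.swap a (a + e) := by
    have h4 := Equiv.swap_apply_apply ρ a (a + e)
    rw [h3 a haZ, h3 _ hbZ] at h4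
    conv_lhs => rw [h4]
    group
  rw [hconj] at h123
  exact ⟨h123, fun y hy => Equiv.swap_apply_of_ne_of_ne (hfar y hy a haZ) (hfar y hy _ hbZ),
    Equiv.swap_apply_of_ne_of_ne hpa' hp⟩

/-- If the tracer is not strictly ahead of `a`, then it is strictly behind `a + e`, and the edge can
be approached from the other end. -/
lemma HasMoves.performable_swap_neighbor (hd : 2 ≤ d) (h : HasMoves G C l) {p a e : Site d}
    (he : e ∈ unitVectors d) (hpa : p ≠ a) (hp : p ≠ a + e) :
    Performable G C p (Equiv.swap a (a + e)) := by
  obtain ⟨α, s, hs, rfl⟩ : ∃ (α : Fin d) (s : ℤ), (s = 1 ∨ s = -1) ∧ e = s • basisVec α := by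
    obtain ⟨α, rfl | rfl⟩ := mem_unitVectors.1 he
    · exact ⟨α, 1, .inl rfl, by simp⟩
    · exact ⟨α, -1, .inr rfl, by simp⟩
  by_cases hlt : s * a α < s * p α
  · exact h.performable_swap_aux hd hs hlt hp
  · have key := h.performable_swap_aux hd (p := p) (a := a + s • basisVec α) (α := α) (s := -s)
      (by omega) (by
        have : (a + s • basisVec α) α = a α + s := by simp [basisVec]
        rw [this]
        rcases hs with rfl | rfl <;> grind) (by simpa using hpa)
    rw [Equiv.swap_comm]
    simpa using key

/-- The complement of the point `p` is a connected graph, and transpositions along its edges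
generate all others by conjugation. -/
lemma HasMoves.performable_swap (hd : 2 ≤ d) (h : HasMoves G C l) {p a b : Site d}
    (ha : a ≠ p) (hb : b ≠ p) : Performable G C p (Equiv.swap a b) := by
  have hout : ∀ z : Site d, z ≠ p ↔ Outside p 0 z := by
    intro z
    simp [Outside, Function.ne_iff, sub_eq_zero]
  refine outside_connected (Q := fun a b => Performable G C p (Equiv.swap a b)) hd
    (fun x => ?_) (fun x y z hxy hyz => ?_) (fun x e he hx hxe => ?_) ((hout a).1 ha)
    ((hout b).1 hb)
  · simpa [Equiv.Perm.one_def] using Performable.one p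
  · by_cases hxz : x = z
    · subst hxz
      simpa [Equiv.Perm.one_def] using Performable.one p
    by_cases hxy' : x = y
    · subst hxy'; exact hyz
    by_cases hyz' : y = z
    · subst hyz'; exact hxy
    · rw [← Equiv.swap_mul_swap_mul_swap (Ne.symm hyz') (Ne.symm hxz), Equiv.swap_comm y x,
        Equiv.swap_comm z y]
      exact (hxy.mul hyz).mul hxy
  · exact h.performable_swap_neighbor hd he ((hout _).2 hx).symm ((hout _).2 hxe).symm

/-- Each transposition of a surplus site `a ∈ S₁ \ S₂` with a missing site `b ∈ S₂ \ S₁` reduces the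
difference by one. -/
lemma HasMoves.performable_image (hd : 2 ≤ d) (h : HasMoves G C l) {p : Site d}
    {S₁ S₂ : Finset (Site d)} (hcard : S₁.card = S₂.card) (h₁ : p ∉ S₁) (h₂ : p ∉ S₂) :
    ∃ π, Performable G C p π ∧ S₁.image π = S₂ := by
  induction hn : (S₁ \ S₂).card generalizing S₁ with
  | zero =>
    refine ⟨1, .one p, ?_⟩
    have : S₁ ⊆ S₂ := Finset.sdiff_eq_empty_iff_subset.1 (Finset.card_eq_zero.1 hn)
    simpa using Finset.eq_of_subset_of_card_le this hcard.ge
  | succ n ih =>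
    obtain ⟨a, ha⟩ : (S₁ \ S₂).Nonempty := Finset.card_pos.1 (by omega)
    obtain ⟨b, hb⟩ : (S₂ \ S₁).Nonempty := by
      refine Finset.card_pos.1 ?_
      rw [Finset.card_sdiff_comm hcard.symm]
      omega
    obtain ⟨ha1, ha2⟩ := Finset.mem_sdiff.1 ha
    obtain ⟨hb2, hb1⟩ := Finset.mem_sdiff.1 hb
    have hap : a ≠ p := by rintro rfl; exact h₁ ha1
    have hbp : b ≠ p := by rintro rfl; exact h₂ hb2
    have himg : S₁.image (Equiv.swap a b) = insert b (S₁.erase a) := by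
      ext z
      simp only [Finset.mem_image, Finset.mem_insert, Finset.mem_erase]
      constructor
      · rintro ⟨w, hw, rfl⟩
        by_cases hwa : w = a
        · simp [hwa]
        · have hwb : w ≠ b := by rintro rfl; exact hb1 hw
          rw [Equiv.swap_apply_of_ne_of_ne hwa hwb]
          exact .inr ⟨hwa, hw⟩
      · rintro (rfl | ⟨hz1, hz2⟩)
        · exact ⟨a, ha1, by simp⟩
        · refine ⟨z, hz2, Equiv.swap_apply_of_ne_of_ne hz1 ?_⟩
          rintro rfl
          exact hb1 hz2
    obtain ⟨π, hπ, hπ'⟩ := ih (S₁ := S₁.image (Equiv.swap a b))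
      (by rw [Finset.card_image_of_injective _ (Equiv.injective _), hcard])
      (by simp [himg, hbp.symm, h₁])
      (by
        have : S₁.image (Equiv.swap a b) \ S₂ = (S₁ \ S₂).erase a := by
          rw [himg]
          ext z
          simp only [Finset.mem_sdiff, Finset.mem_insert, Finset.mem_erase]
          constructor
          · rintro ⟨rfl | hz, hz2⟩
            · exact absurd hb2 hz2
            · exact ⟨hz.1, hz.2, hz2⟩
          · rintro ⟨hz1, hz2, hz3⟩
            exact ⟨.inr ⟨hz1, hz2⟩, hz3⟩
        rw [this, Finset.card_erase_of_mem ha, hn, Nat.add_sub_cancel])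
    refine ⟨π * Equiv.swap a b, hπ.mul (h.performable_swap hd hap hbp), ?_⟩
    rw [← hπ', Finset.image_image]
    rfl

/-- A tracer at the origin can be moved by one step in the direction `e`, in such a way that the
set of sites that have to be empty moves along with the tracer. -/
theorem HasMoves.exists_tracerPath (hd : 2 ≤ d) (h : HasMoves G C l) {e : Site d}
    (he : e ∈ unitVectors d) : ∃ (E : Finset (Site d)) (σ : Equiv.Perm (Site d)),
      TracerPath G E 0 σ ∧ σ 0 = e ∧ (∀ z ∈ E, σ z - e ∈ E) ∧ 0 ∉ E := by
  -- With this centre, the exchange move in direction `-e` is the transposition of `e` and `0`, and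
  -- `0` is the one site of its region outside the box `B`.
  set x₀ : Site d := ((l : ℤ) + 1) • e with hx₀
  set B : Finset (Site d) :=
    Finset.Icc (fun i => x₀ i - (l : ℤ)) (fun i => x₀ i + (l : ℤ)) with hB
  have hmemB : ∀ z, z ∈ B ↔ z ∈ box x₀ l := by
    intro z
    simp only [hB, Finset.mem_Icc, Pi.le_def, box, Set.mem_ofPred_eq, abs_le, ← forall_and]
    refine forall_congr' fun i => ?_
    constructor <;> rintro ⟨h1, h2⟩ <;> constructor <;> linarith
  have h0B : (0 : Site d) ∉ B := by
    rw [hmemB]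
    obtain ⟨α, hα | hα⟩ := mem_unitVectors.1 he
    all_goals
      intro h0
      have h1 := h0 α
      simp only [hx₀, hα, Pi.zero_apply, Pi.smul_apply, Pi.neg_apply, basisVec, Pi.single_eq_same,
        smul_eq_mul] at h1
      grind
  have he0 : e ≠ 0 := by
    obtain ⟨α, rfl | rfl⟩ := mem_unitVectors.1 he <;> simp [basisVec]
  -- After the jump the vacancies of `B` sit at `B.image (Equiv.swap e 0)`. The distant cluster must
  -- bring them to `B + e`; both sets avoid the tracer, now at `e`.
  have hcard : (B.image (Equiv.swap e 0)).card = (B.image (· + e)).card := by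
    rw [Finset.card_image_of_injective _ (Equiv.injective _),
      Finset.card_image_of_injective _ (add_left_injective e)]
  have heB : e ∉ B.image (Equiv.swap e 0) := by
    rw [Finset.mem_image]
    rintro ⟨z, hz, hze⟩
    rw [Equiv.swap_apply_eq_iff, Equiv.swap_apply_left] at hze
    exact h0B (hze ▸ hz)
  have heB' : e ∉ B.image (· + e) := by
    rw [Finset.mem_image]
    rintro ⟨z, hz, hze⟩
    exact h0B ((add_eq_right.1 hze) ▸ hz)
  obtain ⟨π, ⟨K, hK⟩, hπ⟩ := h.performable_image hd hcard heB heB'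
  obtain ⟨K', hK'⟩ := exists_mem_box (insert 0 (insert e (B ∪ B.image (· + e))))
  obtain ⟨X, hX⟩ : ∃ X : Site d, Outside 0 (max K (K' + l)) X := by
    refine ⟨fun _ => (max K (K' + l) : ℕ) + 1, ⟨0, by omega⟩, ?_⟩
    rw [Pi.zero_apply, sub_zero, abs_of_nonneg (by positivity)]
    exact lt_add_one _
  obtain ⟨hπ1, hπ2, hπ3⟩ := hK X (hX.mono (le_max_left _ _))
  have hfar : ∀ z ∈ insert 0 (insert e (B ∪ B.image (· + e))), z ∉ box X l :=
    fun z hz => (hX.mono (le_max_right _ _)).notMem_box (hK' z hz)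
  have hfarC : ∀ z ∈ insert 0 (insert e (B ∪ B.image (· + e))), ∀ y ∈ C, X + y ≠ z := by
    rintro z hz y hy rfl
    exact hfar _ hz (h.cluster_subset_box hd X ⟨y, hy, rfl⟩)
  obtain ⟨τ, hτ1, hτ2, hτ3⟩ := h.translation he X
  -- The two parts are the distant cluster, moved by `τ` at the end, and the box around the tracer's
  -- target, rebuilt by `π`.
  set E : Finset (Site d) := C.image (X + ·) ∪ B with hE
  have hCE : cluster C X ⊆ E := by
    rintro _ ⟨y, hy, rfl⟩
    exact Finset.mem_coe.2 (Finset.mem_union_left _ (Finset.mem_image_of_mem _ hy))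
  have hswapC : ∀ y ∈ C, Equiv.swap e 0 (X + y) = X + y := fun y hy =>
    Equiv.swap_apply_of_ne_of_ne (hfarC e (by simp) y hy) (hfarC 0 (by simp) y hy)
  have h1 : TracerPath G E 0 (Equiv.swap e 0) := by
    have hxa : x₀ + (l : ℤ) • -e = e := by rw [hx₀, add_smul]; simp
    have hxb : x₀ + ((l : ℤ) + 1) • -e = 0 := by rw [hx₀]; simp
    have key := h.exchange (neg_mem_unitVectors he) x₀ (E := (E : Set (Site d))) (p := 0) (by
      intro z hz
      exact Finset.mem_coe.2 (Finset.mem_union_right _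
        ((hmemB z).2 (h.cluster_subset_box hd x₀ hz)))) (by
      rw [hxb]
      rintro - z (hz | hz) hz0
      · exact Finset.mem_coe.2 (Finset.mem_union_right _ ((hmemB z).2 hz))
      · exact absurd hz hz0)
    rwa [hxa, add_neg_cancel] at key
  have h2 : TracerPath G E 0 (π * Equiv.swap e 0) := by
    refine h1.comp (E' := cluster C X) (by rwa [Equiv.swap_apply_right]) ?_
    rintro _ ⟨y, hy, rfl⟩
    refine hCE ⟨y, hy, ?_⟩
    rw [Equiv.Perm.eq_inv_iff_eq, hswapC y hy]
  have h3 : TracerPath G E 0 (τ * (π * Equiv.swap e 0)) := by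
    refine h2.comp (E' := cluster C X) ?_ ?_
    · rw [Equiv.Perm.mul_apply, Equiv.swap_apply_right, hπ3]
      exact hτ1 e (hfar e (by simp))
    · rintro _ ⟨y, hy, rfl⟩
      refine hCE ⟨y, hy, ?_⟩
      rw [Equiv.Perm.eq_inv_iff_eq, Equiv.Perm.mul_apply, hswapC y hy, hπ2 y hy]
  refine ⟨E, _, h3, ?_, fun z hz => ?_, fun h0 => ?_⟩
  · rw [Equiv.Perm.mul_apply, Equiv.Perm.mul_apply, Equiv.swap_apply_right, hπ3]
    exact hτ3 e (hfar e (by simp))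
  · rcases Finset.mem_union.1 hz with hz | hz
    · obtain ⟨y, hy, rfl⟩ := Finset.mem_image.1 hz
      rw [Equiv.Perm.mul_apply, Equiv.Perm.mul_apply, hswapC y hy, hπ2 y hy, hτ2 y hy,
        add_sub_cancel_right]
      exact Finset.mem_union_left _ hz
    · have hz' : π (Equiv.swap e 0 z) ∈ B.image (· + e) := by
        rw [← hπ]
        exact Finset.mem_image_of_mem _ (Finset.mem_image_of_mem _ hz)
      rw [Equiv.Perm.mul_apply, Equiv.Perm.mul_apply, hτ3 _ (hfar _ (by
        simp only [Finset.mem_insert, Finset.mem_union]; exact .inr (.inr (.inr hz'))))]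
      obtain ⟨w, hw, hw'⟩ := Finset.mem_image.1 hz'
      rw [← hw', add_sub_cancel_right]
      exact Finset.mem_union_right _ hw
  · rcases Finset.mem_union.1 h0 with h0 | h0
    · obtain ⟨y, hy, hy'⟩ := Finset.mem_image.1 h0
      exact hfarC 0 (by simp) y hy hy'
    · exact h0B h0

end Clusters

/-! ### Local functions -/

section LocalFunctions

variable {d : ℕ}

lemma isLocal_const (a : ℝ) : IsLocal (fun _ : Config d => a) :=
  ⟨∅, fun _ _ _ => rfl⟩

lemma IsLocal.map₂ {f g : Config d → ℝ} (hf : IsLocal f) (hg : IsLocal g) (F : ℝ → ℝ → ℝ) :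
    IsLocal fun η => F (f η) (g η) := by
  obtain ⟨s, hs⟩ := hf
  obtain ⟨t, ht⟩ := hg
  refine ⟨s ∪ t, fun η ζ h => ?_⟩
  have h1 : f η = f ζ := hs fun z hz => h z (by simp_all)
  have h2 : g η = g ζ := ht fun z hz => h z (by simp_all)
  simp only [h1, h2]

lemma IsLocal.map {f : Config d → ℝ} (hf : IsLocal f) (F : ℝ → ℝ) : IsLocal fun η => F (f η) :=
  hf.map₂ hf fun a _ => F a

lemma IsLocal.comp_act {f : Config d → ℝ} (hf : IsLocal f) (σ : Equiv.Perm (Site d)) :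
    IsLocal fun η => f (act σ η) := by
  obtain ⟨s, hs⟩ := hf
  refine ⟨s.image fun z => σ⁻¹ z, fun η ζ h => hs fun z hz => h _ ?_⟩
  exact Finset.mem_coe.2 (Finset.mem_image_of_mem (fun z => σ⁻¹ z) hz)

lemma isLocal_sum {ι : Type*} (S : Finset ι) {f : ι → Config d → ℝ} (hf : ∀ i ∈ S, IsLocal (f i)) :
    IsLocal fun η => ∑ i ∈ S, f i η := by
  classical
  induction S using Finset.induction_on with
  | empty => simpa using isLocal_const 0
  | insert i S hi ih =>
    simp only [Finset.sum_insert hi]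
    exact (hf i (by simp)).map₂ (ih fun j hj => hf j (by simp [hj])) (· + ·)

/-- Factoring through the finite type `s → Bool` makes local functions measurable and bounded. -/
lemma IsLocal.exists_eq_comp_restrict {f : Config d → ℝ} (hf : IsLocal f) :
    ∃ (s : Finset (Site d)) (g : (s → Bool) → ℝ), f = fun η => g (s.restrict η) := by
  obtain ⟨s, hs⟩ := hf
  refine ⟨s, fun ζ => f fun z => if h : z ∈ s then ζ ⟨z, h⟩ else false, funext fun η => hs ?_⟩
  intro z hz
  simp [Finset.mem_coe.1 hz]

lemma IsLocal.measurable {f : Config d → ℝ} (hf : IsLocal f) : Measurable f := by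
  obtain ⟨s, g, rfl⟩ := hf.exists_eq_comp_restrict
  exact (measurable_of_finite g).comp (Finset.measurable_restrict s)

lemma IsLocal.integrable {f : Config d → ℝ} (hf : IsLocal f) (μ : Measure (Config d))
    [IsFiniteMeasure μ] : Integrable f μ := by
  obtain ⟨s, g, hg⟩ := hf.exists_eq_comp_restrict
  obtain ⟨b, hb⟩ := Finite.exists_le fun ζ => ‖g ζ‖
  refine .of_bound hf.measurable.aestronglyMeasurable b (.of_forall fun η => ?_)
  rw [hg]
  exact hb _

lemma measurableSet_emptyOn (E : Set (Site d)) : MeasurableSet (emptyOn E) := by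
  have : emptyOn E = ⋂ z ∈ E, {η : Config d | η z = false} := by
    ext η
    simp [emptyOn]
  rw [this]
  exact MeasurableSet.biInter E.to_countable fun z _ =>
    measurableSet_eq_fun (measurable_pi_apply z) measurable_const

end LocalFunctions

/-! ### Invariance of the equilibrium and tracer measures -/

section Measures

variable {d : ℕ}

lemma measurableSet_tracer : MeasurableSet {η : Config d | η 0 = true} :=
  measurableSet_eq_fun (measurable_pi_apply (0 : Site d)) measurable_const

instance (q : unitInterval) : IsProbabilityMeasure (equilibrium d q) := by
  unfold equilibrium
  infer_instance

instance (q : unitInterval) : IsFiniteMeasure (tracerMeasure d q) := by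
  unfold tracerMeasure
  infer_instance

lemma measurePreserving_act (q : unitInterval) (σ : Equiv.Perm (Site d)) :
    MeasurePreserving (act σ) (equilibrium d q) (equilibrium d q) := by
  have h : (MeasurableEquiv.piCongrLeft (fun _ : Site d => Bool) σ : Config d → Config d)
      = act σ := by
    funext η y
    obtain ⟨z, rfl⟩ := σ.surjective y
    rw [act_apply, MeasurableEquiv.coe_piCongrLeft, Equiv.piCongrLeft_apply_apply]
  rw [← h]
  exact ⟨MeasurableEquiv.measurable _, 
    Measure.infinitePi_map_piCongrLeft
      (fun _ : Site d => bernoulliMeasure false true q) σ⟩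

lemma measurePreserving_act_tracerMeasure (q : unitInterval) {σ : Equiv.Perm (Site d)}
    (hσ : σ 0 = 0) :
    MeasurePreserving (act σ) (tracerMeasure d q) (tracerMeasure d q) := by
  have h := (measurePreserving_act q σ).restrict_preimage measurableSet_tracer
  have hpre : act σ ⁻¹' {η : Config d | η 0 = true} = {η | η 0 = true} := by
    ext η
    have : act σ η 0 = η 0 := by
      conv_lhs => rw [← hσ, act_apply]
    simp [this]
  rw [hpre] at h
  exact h.smul_measure _

lemma IsLocal.integral_comp_act {f : Config d → ℝ} (hf : IsLocal f) (q : unitInterval)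
    {σ : Equiv.Perm (Site d)} (hσ : σ 0 = 0) :
    ∫ η, f (act σ η) ∂tracerMeasure d q = ∫ η, f η ∂tracerMeasure d q := by
  have h := measurePreserving_act_tracerMeasure (d := d) q hσ
  conv_rhs => rw [← h.map_eq]
  rw [integral_map h.measurable.aemeasurable hf.measurable.aestronglyMeasurable]

lemma IsLocal.setIntegral_comp_act {f : Config d → ℝ} (hf : IsLocal f) (q : unitInterval)
    {σ : Equiv.Perm (Site d)} (hσ : σ 0 = 0) {E : Set (Site d)} (hE : σ '' E = E) :
    ∫ η in emptyOn E, f (act σ η) ∂tracerMeasure d q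
      = ∫ η in emptyOn E, f η ∂tracerMeasure d q := by
  have h := (measurePreserving_act_tracerMeasure (d := d) q hσ).restrict_preimage
    (measurableSet_emptyOn E)
  have hpre : act σ ⁻¹' emptyOn E = emptyOn E := by
    ext η
    rw [Set.mem_preimage, ← act_mem_emptyOn (σ := σ) (η := η), hE]
  rw [hpre] at h
  conv_rhs => rw [← h.map_eq]
  rw [integral_map h.measurable.aemeasurable hf.measurable.aestronglyMeasurable]

/-- As `0 ∉ E`, the conditioning is independent of the event; `q < 1` makes the conditioning event
non-null. -/
lemma tracerMeasure_real_emptyOn {q : unitInterval} (hq : q < 1) {E : Finset (Site d)}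
    (hE : (0 : Site d) ∉ E) : (tracerMeasure d q).real (emptyOn E) = (q : ℝ) ^ E.card := by
  have hset : {η : Config d | η 0 = true} ∩ emptyOn E
      = Set.pi (insert 0 E : Finset (Site d)) fun z => if z = 0 then {true} else {false} := by
    ext η
    simp only [emptyOn, Set.mem_inter_iff, Set.mem_ofPred_eq, Finset.mem_coe, Set.mem_pi,
      Finset.mem_insert, forall_eq_or_imp, if_true, Set.mem_singleton_iff]
    refine and_congr_right fun _ => forall₂_congr fun z hz => ?_
    have : z ≠ 0 := by rintro rfl; exact hE hz
    simp [this]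
  have hone : {η : Config d | η 0 = true}
      = Set.pi ({0} : Finset (Site d)) fun _ => {true} := by
    ext η
    simp
  have htrue : (bernoulliMeasure false true q).real {true} = 1 - q := by
    rw [bernoulliMeasure_real_apply _ (measurableSet_singleton _)]
    simp
  have hfalse : (bernoulliMeasure false true q).real {false} = q := by
    rw [bernoulliMeasure_real_apply _ (measurableSet_singleton _)]
    simp
  have h1 : (equilibrium d q).real {η : Config d | η 0 = true} = 1 - q := by
    rw [hone, measureReal_def, equilibrium, Measure.infinitePi_pi _ (by simp)]
    simp
  have h2 : (equilibrium d q).real ({η : Config d | η 0 = true} ∩ emptyOn E)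
      = (1 - q) * (q : ℝ) ^ E.card := by
    rw [hset, measureReal_def, equilibrium,
      Measure.infinitePi_pi _ (fun _ _ => MeasurableSet.of_discrete), Finset.prod_insert hE,
      ENNReal.toReal_mul, ENNReal.toReal_prod, if_pos rfl]
    congr 1
    rw [← hfalse, ← Finset.prod_const]
    refine Finset.prod_congr rfl fun z hz => ?_
    have : z ≠ 0 := by rintro rfl; exact hE hz
    simp [this, measureReal_def]
  have hq' : (1 : ℝ) - q ≠ 0 := by
    have : (q : ℝ) < 1 := by exact_mod_cast hq
    linarith
  rw [tracerMeasure, measureReal_def, cond_apply measurableSet_tracer, ENNReal.toReal_mul,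
    ENNReal.toReal_inv, ← measureReal_def, ← measureReal_def, h1, h2, inv_mul_cancel_left₀ hq']

end Measures

/-! ### The functional and its individual terms -/

namespace LatticeGas

variable {d : ℕ} (G : LatticeGas d)

lemma rate_nonneg {x y : Site d} (h : Neighbor x y) (η : Config d) : 0 ≤ G.rate x y η := by
  obtain ⟨c, -, hc⟩ := G.rate_mem
  rcases hc x y h η with h | h
  · exact h.ge
  · exact zero_le_one.trans h.1

lemma isLocal_rate {x y : Site d} (h : Neighbor x y) : IsLocal (G.rate x y) := by
  obtain ⟨R, hR⟩ := G.rate_range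
  refine ⟨Finset.Icc (fun i => x i - (R : ℤ)) (fun i => x i + (R : ℤ)), (hR x y h).mono ?_⟩
  intro z hz
  simp only [Finset.coe_Icc, Set.mem_Icc, Pi.le_def, ← forall_and]
  intro i
  have := abs_le.1 (hz i)
  constructor <;> linarith

lemma neighbor_add {x e : Site d} (he : e ∈ unitVectors d) : Neighbor x (x + e) := by
  simpa [Neighbor] using neg_mem_unitVectors he

lemma neighbor_zero {y : Site d} (hy : y ∈ unitVectors d) : Neighbor 0 y := by
  simpa using neighbor_add (x := 0) hy

lemma basisVec_mem (α : Fin d) : basisVec α ∈ unitVectors d :=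
  mem_unitVectors.2 ⟨α, .inl rfl⟩

lemma edgeTerm_nonneg {x y : Site d} (h : Neighbor x y) (f : Config d → ℝ) (η : Config d) :
    0 ≤ G.edgeTerm f x y η :=
  mul_nonneg (G.rate_nonneg h η) (sq_nonneg _)

lemma jumpTerm_nonneg {y : Site d} (hy : y ∈ unitVectors d) (u : Fin d → ℝ) (f : Config d → ℝ)
    (η : Config d) : 0 ≤ G.jumpTerm u f y η := by
  refine mul_nonneg (mul_nonneg (G.rate_nonneg (neighbor_zero hy) η) ?_) (sq_nonneg _)
  split_ifs <;> norm_num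

lemma isLocal_edgeTerm {x y : Site d} (h : Neighbor x y) {f : Config d → ℝ} (hf : IsLocal f) :
    IsLocal (G.edgeTerm f x y) :=
  (G.isLocal_rate h).map₂ ((hf.comp_act (Equiv.swap x y)).map₂ hf fun a b => (a - b) ^ 2) (· * ·)

lemma isLocal_jumpTerm {y : Site d} (hy : y ∈ unitVectors d) (u : Fin d → ℝ) {f : Config d → ℝ}
    (hf : IsLocal f) : IsLocal (G.jumpTerm u f y) := by
  have h1 : IsLocal fun η : Config d => if η y = true then (0 : ℝ) else 1 :=
    ⟨{y}, fun η ζ h => by simp [h y (by simp)]⟩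
  have h2 : IsLocal fun η => f (shift (-y) (exchange 0 y η)) :=
    (hf.comp_act (Equiv.addRight (-y))).comp_act (Equiv.swap 0 y)
  exact ((G.isLocal_rate (neighbor_zero hy)).map₂ h1 (· * ·)).map₂
    (h2.map₂ hf fun a b => (siteDot u y + a - b) ^ 2) (· * ·)

/-- The contribution of the edges with lower end in `S`, and of the jumps of the tracer, to the
density of the functional. -/
noncomputable def density (S : Finset (Site d)) (u : Fin d → ℝ) (f : Config d → ℝ)
    (η : Config d) : ℝ :=
  (∑ x ∈ S, ∑ α : Fin d,
    if x ≠ 0 ∧ x + basisVec α ≠ 0 then G.edgeTerm f x (x + basisVec α) η else 0) +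
  ∑ y ∈ unitVectors d, G.jumpTerm u f y η

lemma isLocal_density (S : Finset (Site d)) (u : Fin d → ℝ) {f : Config d → ℝ}
    (hf : IsLocal f) : IsLocal (G.density S u f) := by
  refine (isLocal_sum S fun x _ => isLocal_sum _ fun α _ => ?_).map₂
    (isLocal_sum _ fun y hy => G.isLocal_jumpTerm hy u hf) (· + ·)
  split_ifs
  · exact G.isLocal_edgeTerm (neighbor_add (basisVec_mem α)) hf
  · exact isLocal_const 0

/-- An edge with both ends off the support of `f` contributes nothing. Allowing every larger `S'`
gives several functions a common finite sum. -/
lemma exists_tracerFunctional_eq {f : Config d → ℝ} (hf : IsLocal f) :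
    ∃ S : Finset (Site d), ∀ S', S ⊆ S' → ∀ q u,
      G.tracerFunctional q u f = ∫ η, G.density S' u f η ∂tracerMeasure d q := by
  obtain ⟨s, hs⟩ := hf
  refine ⟨s ∪ Finset.univ.biUnion fun α => s.image (· - basisVec α), fun S' hS q u => ?_⟩
  refine integral_congr_ae (.of_forall fun η => ?_)
  simp only [density]
  congr 1
  refine tsum_eq_sum fun x hx => Finset.sum_eq_zero fun α _ => ?_
  have hx1 : x ∉ s := fun h => hx (hS (Finset.mem_union_left _ h))
  have hx2 : x + basisVec α ∉ s := fun h => hx (hS (Finset.mem_union_right _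
    (Finset.mem_biUnion.2 ⟨α, Finset.mem_univ _, Finset.mem_image.2 ⟨_, h, by simp⟩⟩)))
  have : f (KCLG.exchange x (x + basisVec α) η) = f η := by
    refine hs fun z hz => ?_
    have h1 : z ≠ x := by rintro rfl; exact hx1 hz
    have h2 : z ≠ x + basisVec α := by rintro rfl; exact hx2 hz
    rw [KCLG.exchange, act, Equiv.swap_inv, Equiv.swap_apply_of_ne_of_ne h1 h2]
  simp [edgeTerm, this]

lemma edgeSum_nonneg (f : Config d → ℝ) (η : Config d) (x : Site d) (α : Fin d) :
    0 ≤ if x ≠ 0 ∧ x + basisVec α ≠ 0 then G.edgeTerm f x (x + basisVec α) η else 0 := by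
  split_ifs
  · exact G.edgeTerm_nonneg (neighbor_add (basisVec_mem α)) f η
  · exact le_rfl

lemma tracerFunctional_nonneg (q : unitInterval) (u : Fin d → ℝ) (f : Config d → ℝ) :
    0 ≤ G.tracerFunctional q u f :=
  integral_nonneg fun η => add_nonneg
    (tsum_nonneg fun x => Finset.sum_nonneg fun α _ => G.edgeSum_nonneg f η x α)
    (Finset.sum_nonneg fun _ hy => G.jumpTerm_nonneg hy u f η)

lemma integral_edgeTerm_le {x y : Site d} (h : Neighbor x y) (hx : x ≠ 0) (hy : y ≠ 0)
    {f : Config d → ℝ} (hf : IsLocal f) (q : unitInterval) (u : Fin d → ℝ) :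
    ∫ η, G.edgeTerm f x y η ∂tracerMeasure d q ≤ G.tracerFunctional q u f := by
  obtain ⟨S, hS⟩ := G.exists_tracerFunctional_eq hf
  -- The sum lists an edge under its lower end, which may be `x` or `y`, so both are included.
  rw [hS (insert x (insert y S)) (by grind)]
  refine integral_mono ((G.isLocal_edgeTerm h hf).integrable _)
    ((G.isLocal_density _ u hf).integrable _) fun η => ?_
  have key : ∀ (z : Site d) (α : Fin d), z ∈ insert x (insert y S) → z ≠ 0 →
      z + basisVec α ≠ 0 →
      G.edgeTerm f z (z + basisVec α) η ≤ G.density (insert x (insert y S)) u f η := by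
    intro z α hz h1 h2
    refine le_trans ?_ (le_add_of_nonneg_right
      (Finset.sum_nonneg fun y hy => G.jumpTerm_nonneg hy u f η))
    refine le_trans ?_ (Finset.single_le_sum (fun x _ =>
      Finset.sum_nonneg fun α _ => G.edgeSum_nonneg f η x α) hz)
    refine le_trans ?_ (Finset.single_le_sum
      (fun α _ => G.edgeSum_nonneg f η z α) (Finset.mem_univ α))
    rw [if_pos ⟨h1, h2⟩]
  obtain ⟨α, hα | hα⟩ := mem_unitVectors.1 h
  · have hxy : x = y + basisVec α := by rw [← hα]; abel
    have hsymm : G.edgeTerm f x y η = G.edgeTerm f y x η := by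
      simp only [edgeTerm, KCLG.exchange, G.rate_symm x y h, Equiv.swap_comm x y]
    rw [hsymm, hxy]
    rw [hxy] at key hx
    exact key y α (by simp) hy hx
  · have hyx : y = x + basisVec α := by rw [← neg_eq_iff_eq_neg] at hα; rw [← hα]; abel
    rw [hyx]
    rw [hyx] at key hy
    exact key x α (by simp) hx hy

lemma integral_jumpTerm_le {y : Site d} (hy : y ∈ unitVectors d) {f : Config d → ℝ}
    (hf : IsLocal f) (q : unitInterval) (u : Fin d → ℝ) :
    ∫ η, G.jumpTerm u f y η ∂tracerMeasure d q ≤ G.tracerFunctional q u f := by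
  obtain ⟨S, hS⟩ := G.exists_tracerFunctional_eq hf
  rw [hS S subset_rfl]
  refine integral_mono ((G.isLocal_jumpTerm hy u hf).integrable _)
    ((G.isLocal_density _ u hf).integrable _) fun η => ?_
  refine le_trans ?_ (le_add_of_nonneg_left
    (Finset.sum_nonneg fun x _ => Finset.sum_nonneg fun α _ => G.edgeSum_nonneg f η x α))
  exact Finset.single_le_sum (f := fun y => G.jumpTerm u f y η)
    (fun _ hy => G.jumpTerm_nonneg hy u f η) hy

end LatticeGas

/-! ### Energy estimate along a tracer path -/

section Energy

variable {d : ℕ} {G : LatticeGas d}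

lemma siteDot_add (u : Fin d → ℝ) (x y : Site d) :
    siteDot u (x + y) = siteDot u x + siteDot u y := by
  simp [siteDot, mul_add, Finset.sum_add_distrib]

lemma shift_exchange (z x y : Site d) (η : Config d) :
    shift z (exchange x y η) = exchange (x + z) (y + z) (shift z η) := by
  have h := Equiv.mul_swap_eq_swap_mul (Equiv.addRight z) x y
  simp only [Equiv.coe_addRight] at h
  rw [shift, exchange, exchange, shift, ← act_mul, ← act_mul, h]

lemma shift_shift (z w : Site d) (η : Config d) : shift z (shift w η) = shift (w + z) η := by
  rw [shift, shift, shift, ← act_mul]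
  congr 1
  ext y
  simp [add_assoc]

lemma shift_apply (z x : Site d) (η : Config d) : shift z η (x + z) = η x :=
  act_apply (Equiv.addRight z) η x

/-- The squared change of `u · p + f`, seen from the tracer at `p`, when `x` and `y` are
exchanged, is at most the corresponding term of the functional. -/
lemma jump_sq_le {x y : Site d} (hxy : Neighbor x y) {ξ : Config d} (hrate : 1 ≤ G.rate x y ξ)
    (hy : ξ y = false) (u : Fin d → ℝ) (f : Config d → ℝ) :
    (siteDot u (y - x) + f (shift (-y) (exchange x y ξ)) - f (shift (-x) ξ)) ^ 2
      ≤ G.jumpTerm u f (y - x) (shift (-x) ξ) := by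
  have h1 : G.rate 0 (y - x) (shift (-x) ξ) = G.rate x y ξ := by
    rw [G.rate_translate x y hxy (-x), add_neg_cancel, sub_eq_add_neg]
  have h2 : shift (-x) ξ (y - x) = false := by
    rw [sub_eq_add_neg, shift_apply, hy]
  have h3 : shift (-(y - x)) (exchange 0 (y - x) (shift (-x) ξ))
      = shift (-y) (exchange x y ξ) := by
    have h4 := shift_exchange (-x) x y ξ
    rw [add_neg_cancel, ← sub_eq_add_neg] at h4
    rw [← h4, shift_shift]
    congr 1
    abel
  rw [LatticeGas.jumpTerm, h1, h2, h3]
  simp only [Bool.false_eq_true, if_false, mul_one]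
  exact le_mul_of_one_le_left (sq_nonneg _) hrate

lemma exchange_sq_le {x y p : Site d} (hxy : Neighbor x y) {ξ : Config d}
    (hrate : 1 ≤ G.rate x y ξ) (f : Config d → ℝ) :
    (f (shift (-p) (exchange x y ξ)) - f (shift (-p) ξ)) ^ 2
      ≤ G.edgeTerm f (x - p) (y - p) (shift (-p) ξ) := by
  have h1 : G.rate (x - p) (y - p) (shift (-p) ξ) = G.rate x y ξ := by
    rw [G.rate_translate x y hxy (-p), ← sub_eq_add_neg, ← sub_eq_add_neg]
  rw [LatticeGas.edgeTerm, h1, sub_eq_add_neg x, sub_eq_add_neg y, ← shift_exchange]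
  exact le_mul_of_one_le_left (sq_nonneg _) hrate

/-- Change of variables: `π` fixes the origin and so preserves the tracer measure. Once `g ∘ act π`
dominates, positivity allows the restriction to `emptyOn E` to be dropped. -/
lemma setIntegral_sq_le {E : Set (Site d)} {π : Equiv.Perm (Site d)} (hπ : π 0 = 0)
    {δ g : Config d → ℝ} (hδ : IsLocal δ) (hg : IsLocal g) (hg0 : ∀ η, 0 ≤ g η)
    (h : ∀ η ∈ emptyOn E, δ η ^ 2 ≤ g (act π η)) (q : unitInterval) :
    ∫ η in emptyOn E, δ η ^ 2 ∂tracerMeasure d q ≤ ∫ η, g η ∂tracerMeasure d q := by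
  rw [← hg.integral_comp_act q hπ]
  refine le_trans ?_ (setIntegral_le_integral (s := emptyOn E) ((hg.comp_act π).integrable _)
    (.of_forall fun η => hg0 _))
  exact setIntegral_mono_on ((hδ.map (· ^ 2)).integrable _).integrableOn
    ((hg.comp_act π).integrable _).integrableOn (measurableSet_emptyOn E) h

/-- Induction on the path: by `(a + b)² ≤ 2a² + 2b²`, each exchange adds twice its own squared
increment, which costs at most one copy of the functional. -/
lemma TracerPath.energy_le {E : Set (Site d)} {σ : Equiv.Perm (Site d)}
    (h : TracerPath G E 0 σ) : ∃ K : ℝ, 0 ≤ K ∧ ∀ (q : unitInterval) (u : Fin d → ℝ)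
      (f : Config d → ℝ), IsLocal f →
      ∫ η in emptyOn E, (siteDot u (σ 0) + f (shift (-σ 0) (act σ η)) - f η) ^ 2
        ∂tracerMeasure d q ≤ K * G.tracerFunctional q u f := by
  induction h with
  | refl =>
    refine ⟨0, le_rfl, fun q u f hf => ?_⟩
    have : ∀ η : Config d, shift (0 : Site d) η = η := by
      intro η
      funext z
      simpa using shift_apply (0 : Site d) z η
    simp [siteDot, this, act_one]
  | @step σ x y h hxy hrate hempty ih =>
    obtain ⟨K, hK0, hK⟩ := ih
    refine ⟨2 * K + 2, by positivity, fun q u f hf => ?_⟩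
    set p := σ 0 with hp
    set s := Equiv.swap x y with hs
    have hsp : (s * σ) 0 = s p := rfl
    rw [hsp]
    have hloc : ∀ (a : ℝ) (z w : Site d) (ρ ρ' : Equiv.Perm (Site d)),
        IsLocal fun η => a + f (shift z (act ρ η)) - f (shift w (act ρ' η)) := fun a z w ρ ρ' =>
      (((hf.comp_act (Equiv.addRight z)).comp_act ρ).map (a + ·)).map₂
        ((hf.comp_act (Equiv.addRight w)).comp_act ρ') (· - ·)
    set δ : Config d → ℝ := fun η => siteDot u (s p - p) + f (shift (-s p) (act (s * σ) η))
      - f (shift (-p) (act σ η)) with hδ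
    -- `act π η` is the configuration before the current exchange, recentred at the tracer.
    set π : Equiv.Perm (Site d) := Equiv.addRight (-p) * σ with hπ
    have hπ0 : π 0 = 0 := by simp [hπ, ← hp]
    have hπact : ∀ η, act π η = shift (-p) (act σ η) := fun η => act_mul _ _ _
    have hδloc : IsLocal δ := hloc _ _ _ _ _
    have hswap : ∀ η, act (s * σ) η = exchange x y (act σ η) := fun η => act_mul _ _ _
    have hyx : Neighbor y x := by
      have := neg_mem_unitVectors hxy
      rwa [neg_sub] at this
    have hδK : ∫ η in emptyOn E, δ η ^ 2 ∂tracerMeasure d q ≤ G.tracerFunctional q u f := by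
      by_cases hpx : p = x
      · have hspy : s p = y := by rw [hpx]; exact Equiv.swap_apply_left x y
        have hmem : y - x ∈ unitVectors d := hyx
        refine (setIntegral_sq_le hπ0 hδloc (G.isLocal_jumpTerm hmem u hf)
          (G.jumpTerm_nonneg hmem u f) (fun η hη => ?_) q).trans
          (G.integral_jumpTerm_le hmem hf q u)
        have he := hempty (.inl hpx) η hη
        rw [hspy] at he
        have := jump_sq_le hxy (hrate η hη) he u f
        simp only [hδ, hspy, hswap, hπact]
        rw [hpx]
        exact this
      by_cases hpy : p = y
      · have hspy : s p = x := by rw [hpy]; exact Equiv.swap_apply_right x y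
        have hmem : x - y ∈ unitVectors d := hxy
        refine (setIntegral_sq_le hπ0 hδloc (G.isLocal_jumpTerm hmem u hf)
          (G.jumpTerm_nonneg hmem u f) (fun η hη => ?_) q).trans
          (G.integral_jumpTerm_le hmem hf q u)
        have he := hempty (.inr hpy) η hη
        rw [hspy] at he
        have hr := hrate η hη
        rw [G.rate_symm x y hxy] at hr
        have := jump_sq_le hyx hr he u f
        rw [exchange, Equiv.swap_comm y x] at this
        simp only [hδ, hspy, hswap, hπact]
        rw [hpy]
        exact this
      · have hspp : s p = p := Equiv.swap_apply_of_ne_of_ne hpx hpy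
        have hnb : Neighbor (x - p) (y - p) := by
          rwa [Neighbor, sub_sub_sub_cancel_right]
        refine (setIntegral_sq_le hπ0 hδloc (G.isLocal_edgeTerm hnb hf)
          (G.edgeTerm_nonneg hnb f) (fun η hη => ?_) q).trans
          (G.integral_edgeTerm_le hnb (sub_ne_zero.2 (Ne.symm hpx)) (sub_ne_zero.2 (Ne.symm hpy))
            hf q u)
        have := exchange_sq_le (p := p) hxy (hrate η hη) f
        have h0 : siteDot u (0 : Site d) = 0 := by simp [siteDot]
        simpa only [hδ, hspp, hswap, hπact, sub_self, h0, zero_add] using this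
    have hold := hK q u f hf
    have hid : ∀ η : Config d, shift (0 : Site d) (act 1 η) = η := by
      intro η
      funext z
      simpa [act_one] using shift_apply (0 : Site d) z η
    have hloc' : ∀ (a : ℝ) (z : Site d) (ρ : Equiv.Perm (Site d)),
        IsLocal fun η => (a + f (shift z (act ρ η)) - f η) ^ 2 := fun a z ρ => by
      simpa only [hid] using (hloc a z 0 ρ 1).map (· ^ 2)
    have h1 := ((hloc' (siteDot u p) (-p) σ).integrable
      ((tracerMeasure d q).restrict (emptyOn E))).const_mul 2
    have h2 := ((hδloc.map (· ^ 2)).integrable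
      ((tracerMeasure d q).restrict (emptyOn E))).const_mul 2
    calc ∫ η in emptyOn E, (siteDot u (s p) + f (shift (-s p) (act (s * σ) η)) - f η) ^ 2
          ∂tracerMeasure d q
        ≤ ∫ η in emptyOn E, (2 * (siteDot u p + f (shift (-p) (act σ η)) - f η) ^ 2
            + 2 * δ η ^ 2) ∂tracerMeasure d q := by
          refine integral_mono ((hloc' _ _ _).integrable _) (h1.add h2) fun η => ?_
          have h3 : siteDot u (s p) = siteDot u p + siteDot u (s p - p) := by
            rw [← siteDot_add, add_sub_cancel]
          simp only [hδ, h3]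
          nlinarith [sq_nonneg ((siteDot u p + f (shift (-p) (act σ η)) - f η) -
            (siteDot u (s p - p) + f (shift (-s p) (act (s * σ) η)) - f (shift (-p) (act σ η))))]
      _ = 2 * ∫ η in emptyOn E, (siteDot u p + f (shift (-p) (act σ η)) - f η) ^ 2
            ∂tracerMeasure d q + 2 * ∫ η in emptyOn E, δ η ^ 2 ∂tracerMeasure d q := by
          rw [integral_add h1 h2, integral_const_mul, integral_const_mul]
      _ ≤ (2 * K + 2) * G.tracerFunctional q u f := by linarith

/-- If a path moves the tracer, together with the set of sites that have to be empty, then the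
functional is bounded from below. -/
lemma TracerPath.sq_le {E : Finset (Site d)} {σ : Equiv.Perm (Site d)} {e : Site d}
    (h : TracerPath G E 0 σ) (hσ : σ 0 = e) (hE : ∀ z ∈ E, σ z - e ∈ E) (h0 : 0 ∉ E) :
    ∃ K : ℝ, 0 ≤ K ∧ ∀ (q : unitInterval), q < 1 → ∀ (u : Fin d → ℝ) (f : Config d → ℝ),
      IsLocal f → (q : ℝ) ^ E.card * siteDot u e ^ 2 ≤ K * G.tracerFunctional q u f := by
  obtain ⟨K, hK0, hK⟩ := h.energy_le
  refine ⟨K, hK0, fun q hq u f hf => le_trans ?_ (hK q u f hf)⟩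
  rw [hσ]
  set π : Equiv.Perm (Site d) := Equiv.addRight (-e) * σ with hπ
  have hπ0 : π 0 = 0 := by simp [hπ, hσ]
  -- An injective map of a finite set into itself is onto.
  have hπE : π '' E = E := by
    have hsub : E.image π ⊆ E := by
      intro w hw
      obtain ⟨z, hz, rfl⟩ := Finset.mem_image.1 hw
      simpa [hπ, sub_eq_add_neg] using hE z hz
    have := Finset.eq_of_subset_of_card_le hsub
      (Finset.card_image_of_injective _ π.injective).ge
    rw [← Finset.coe_image, this]
  have hπact : ∀ η, shift (-e) (act σ η) = act π η := fun η => (act_mul _ _ _).symm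
  simp only [hπact]
  set t := siteDot u e
  set ν := (tracerMeasure d q).restrict (emptyOn E) with hν
  have hint : ∫ η, (f (act π η) - f η) ∂ν = 0 := by
    rw [integral_sub ((hf.comp_act π).integrable _) (hf.integrable _),
      hf.setIntegral_comp_act q hπ0 hπE, sub_self]
  have hmass : ∫ _η, t ^ 2 ∂ν = (q : ℝ) ^ E.card * t ^ 2 := by
    rw [integral_const, hν, measureReal_restrict_apply_univ, tracerMeasure_real_emptyOn hq h0,
      smul_eq_mul]
  have hdiff : IsLocal fun η => f (act π η) - f η := (hf.comp_act π).map₂ hf (· - ·)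
  calc (q : ℝ) ^ E.card * t ^ 2
      = ∫ η, (t ^ 2 + 2 * t * (f (act π η) - f η)) ∂ν := by
        rw [integral_add (integrable_const _) ((hdiff.integrable _).const_mul _),
          integral_const_mul, hint, hmass, mul_zero, add_zero]
    -- Only the square of the increment of `f` is discarded; the cross term has already been seen to
    -- integrate to zero by invariance.
    _ ≤ ∫ η, (t + f (act π η) - f η) ^ 2 ∂ν := by
        refine integral_mono ((hdiff.map fun a => t ^ 2 + 2 * t * a).integrable _)
          (((hf.comp_act π).map₂ hf fun a b => (t + a - b) ^ 2).integrable _) fun η => ?_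
        simp only
        nlinarith [sq_nonneg (f (act π η) - f η)]

end Energy

/-! ### Quadratic forms from the parallelogram law -/

section QuadraticForms

variable {d : ℕ}

/-- Subtracting `t * φ 1` leaves an additive function that vanishes on the integers. It is therefore
1-periodic and bounded on the whole line, and a bounded additive function is zero. -/
lemma eq_mul_of_additive_of_bounded {φ : ℝ → ℝ} (hadd : ∀ s t, φ (s + t) = φ s + φ t)
    {b : ℝ} (hb : ∀ t ∈ Set.Icc (0 : ℝ) 1, |φ t| ≤ b) (t : ℝ) : φ t = t * φ 1 := by
  let F : ℝ →+ ℝ := AddMonoidHom.mk' (fun t => φ t - t * φ 1) fun s t => by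
    rw [hadd]
    ring
  have hF : ∀ t, |F t| ≤ b + |φ 1| := by
    intro t
    have h1 : F t = F (Int.fract t) := by
      have h2 : F ((⌊t⌋ : ℤ) : ℝ) = 0 := by
        have h3 : F ((⌊t⌋ : ℤ) : ℝ) = ⌊t⌋ • F 1 := by rw [← map_zsmul]; simp
        rw [h3]
        simp [F]
      conv_lhs => rw [← Int.floor_add_fract t, map_add, h2, zero_add]
    rw [h1]
    have h0 := Int.fract_nonneg t
    have h1 := (Int.fract_lt_one t).le
    calc |φ (Int.fract t) - Int.fract t * φ 1| ≤ |φ (Int.fract t)| + |Int.fract t * φ 1| :=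
          abs_sub _ _
      _ ≤ b + |φ 1| := by
          refine add_le_add (hb _ ⟨h0, h1⟩) ?_
          rw [abs_mul, abs_of_nonneg h0]
          exact mul_le_of_le_one_left (abs_nonneg _) h1
  have hzero : F t = 0 := by
    by_contra hne
    obtain ⟨n, hn⟩ := exists_nat_gt ((b + |φ 1|) / |F t|)
    have h1 := hF (n • t)
    rw [map_nsmul, nsmul_eq_mul, abs_mul, Nat.abs_cast] at h1
    rw [div_lt_iff₀ (abs_pos.2 hne)] at hn
    linarith
  have : φ t - t * φ 1 = 0 := hzero
  linarith

/-- A nonnegative function that satisfies the parallelogram law and is homogeneous of degree two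
is the quadratic form of a symmetric matrix. -/
lemma exists_matrix_of_parallelogram {F : (Fin d → ℝ) → ℝ} (hnonneg : ∀ u, 0 ≤ F u)
    (hpar : ∀ u v, F (u + v) + F (u - v) = 2 * F u + 2 * F v)
    (hsmul : ∀ (t : ℝ) u, F (t • u) = t ^ 2 * F u) :
    ∃ D : Matrix (Fin d) (Fin d) ℝ, D.IsSymm ∧ ∀ u, u ⬝ᵥ D.mulVec u = F u := by
  have hneg : ∀ u, F (-u) = F u := fun u => by simpa using hsmul (-1) u
  set B : (Fin d → ℝ) → (Fin d → ℝ) → ℝ := fun u v => (F (u + v) - F (u - v)) / 4 with hB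
  have hsymm : ∀ u v, B u v = B v u := by
    intro u v
    simp only [hB]
    rw [add_comm u v, ← neg_sub v u, hneg]
  have htwo : ∀ u v, B ((2 : ℝ) • u) v = 2 * B u v := by
    intro u v
    have h1 := hpar (u + v) u
    have h2 := hpar (u - v) u
    have e1 : u + v + u = (2 : ℝ) • u + v := by rw [two_smul]; abel
    have e2 : u + v - u = v := by abel
    have e3 : u - v + u = (2 : ℝ) • u - v := by rw [two_smul]; abel
    have e4 : u - v - u = -v := by abel
    rw [e1, e2] at h1
    rw [e3, e4, hneg] at h2
    simp only [hB]
    linarith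
  -- With `u = a + b` and `w = a - b`, the parallelogram laws for `(a + v, b)` and `(a - v, b)`
  -- subtract to `B u v + B w v = 2 * B a v`.
  have hadd : ∀ u w v, B (u + w) v = B u v + B w v := by
    intro u w v
    set a := (1 / 2 : ℝ) • (u + w) with ha
    set b := (1 / 2 : ℝ) • (u - w) with hb
    have hab : a + b = u := by rw [ha, hb]; module
    have hab' : a - b = w := by rw [ha, hb]; module
    have h2a : u + w = (2 : ℝ) • a := by rw [ha]; module
    have h1 := hpar (a + v) b
    have h2 := hpar (a - v) b
    have e1 : a + v + b = u + v := by rw [← hab]; abel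
    have e2 : a + v - b = w + v := by rw [← hab']; abel
    have e3 : a - v + b = u - v := by rw [← hab]; abel
    have e4 : a - v - b = w - v := by rw [← hab']; abel
    rw [e1, e2] at h1
    rw [e3, e4] at h2
    rw [h2a, htwo]
    simp only [hB]
    linarith
  have hlin : ∀ (t : ℝ) u v, B (t • u) v = t * B u v := by
    intro t u v
    -- The bound comes from `4 |B (t • u) v| ≤ F (t • u + v) + F (t • u - v)`, the parallelogram law
    -- and `t² ≤ 1`.
    have h := eq_mul_of_additive_of_bounded (φ := fun t => B (t • u) v)
      (fun s t => by rw [add_smul, hadd]) (b := (2 * F u + 2 * F v) / 4) (fun t ht => ?_) t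
    · simpa using h
    · have h1 := hpar (t • u) v
      have h2 := hnonneg (t • u + v)
      have h3 := hnonneg (t • u - v)
      have h4 : F (t • u) ≤ F u := by
        rw [hsmul]
        exact mul_le_of_le_one_left (hnonneg u) (pow_le_one₀ ht.1 ht.2)
      simp only [hB]
      rw [abs_le]
      constructor <;> linarith
  let L : (Fin d → ℝ) →ₗ[ℝ] (Fin d → ℝ) →ₗ[ℝ] ℝ := LinearMap.mk₂ ℝ B hadd hlin
    (fun u v w => by rw [hsymm, hadd, hsymm v, hsymm w])
    (fun t u v => by rw [hsymm, hlin, hsymm v, smul_eq_mul])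
  refine ⟨LinearMap.toMatrix₂' ℝ L, ?_, fun u => ?_⟩
  · ext i j
    simp only [Matrix.transpose_apply, LinearMap.toMatrix₂'_apply]
    exact hsymm _ _
  · rw [← Matrix.toLinearMap₂'_apply', Matrix.toLinearMap₂'_toMatrix']
    change B u u = F u
    have h0 := hsmul 0 u
    have h2 := hsmul 2 u
    simp only [hB, sub_self]
    rw [zero_smul] at h0
    rw [two_smul] at h2
    rw [h0, h2]
    ring

/-- Polarization on pairs of basis vectors recovers every entry. -/
lemma eq_of_isSymm_of_dotProduct_mulVec {D D' : Matrix (Fin d) (Fin d) ℝ} (hD : D.IsSymm)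
    (hD' : D'.IsSymm) (h : ∀ u, u ⬝ᵥ D.mulVec u = u ⬝ᵥ D'.mulVec u) : D = D' := by
  ext i j
  have key : ∀ A : Matrix (Fin d) (Fin d) ℝ, A.IsSymm →
      (Pi.single i 1 + Pi.single j 1 : Fin d → ℝ) ⬝ᵥ A.mulVec (Pi.single i 1 + Pi.single j 1)
        = (Pi.single i 1 : Fin d → ℝ) ⬝ᵥ A.mulVec (Pi.single i 1)
          + (Pi.single j 1 : Fin d → ℝ) ⬝ᵥ A.mulVec (Pi.single j 1) + 2 * A i j := by
    intro A hA
    have h1 := hA.apply i j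
    simp [Matrix.mulVec_add, add_dotProduct, dotProduct_add, h1]
    ring
  have h1 := key D hD
  have h2 := key D' hD'
  rw [h, h, h] at h1
  linarith

end QuadraticForms

/-! ### The self-diffusion form: quadraticity and lower bound -/

section SelfDiffusion

variable {d : ℕ} (G : LatticeGas d)

namespace LatticeGas

lemma density_parallelogram (S : Finset (Site d)) (u v : Fin d → ℝ) (f g : Config d → ℝ)
    (η : Config d) :
    G.density S (u + v) (f + g) η + G.density S (u - v) (f - g) η
      = 2 * G.density S u f η + 2 * G.density S v g η := by
  have h1 : ∀ (x : Site d) (y : Site d), G.edgeTerm (f + g) x y η + G.edgeTerm (f - g) x y η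
      = 2 * G.edgeTerm f x y η + 2 * G.edgeTerm g x y η := by
    intro x y
    simp only [edgeTerm, Pi.add_apply, Pi.sub_apply]
    ring
  have h2 : ∀ y : Site d, G.jumpTerm (u + v) (f + g) y η + G.jumpTerm (u - v) (f - g) y η
      = 2 * G.jumpTerm u f y η + 2 * G.jumpTerm v g y η := by
    intro y
    have ha : siteDot (u + v) y = siteDot u y + siteDot v y := by
      simp [siteDot, add_mul, Finset.sum_add_distrib]
    have hs : siteDot (u - v) y = siteDot u y - siteDot v y := by
      simp [siteDot, sub_mul, Finset.sum_sub_distrib]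
    simp only [jumpTerm, Pi.add_apply, Pi.sub_apply, ha, hs]
    ring
  set D : (Config d → ℝ) → Site d → Fin d → ℝ := fun f x α =>
    if x ≠ 0 ∧ x + basisVec α ≠ 0 then G.edgeTerm f x (x + basisVec α) η else 0
  have h3 : ∑ x ∈ S, ∑ α, D (f + g) x α + ∑ x ∈ S, ∑ α, D (f - g) x α
      = 2 * ∑ x ∈ S, ∑ α, D f x α + 2 * ∑ x ∈ S, ∑ α, D g x α := by
    simp only [Finset.mul_sum, ← Finset.sum_add_distrib]
    refine Finset.sum_congr rfl fun x _ => Finset.sum_congr rfl fun α _ => ?_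
    simp only [D]
    split_ifs
    · exact h1 _ _
    · simp
  have h4 : ∑ y ∈ unitVectors d, G.jumpTerm (u + v) (f + g) y η
      + ∑ y ∈ unitVectors d, G.jumpTerm (u - v) (f - g) y η
      = 2 * ∑ y ∈ unitVectors d, G.jumpTerm u f y η
        + 2 * ∑ y ∈ unitVectors d, G.jumpTerm v g y η := by
    simp only [Finset.mul_sum, ← Finset.sum_add_distrib]
    exact Finset.sum_congr rfl fun y _ => h2 y
  simp only [density]
  linarith

lemma density_smul (S : Finset (Site d)) (t : ℝ) (u : Fin d → ℝ) (f : Config d → ℝ)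
    (η : Config d) : G.density S (t • u) (t • f) η = t ^ 2 * G.density S u f η := by
  have hs : ∀ y : Site d, siteDot (t • u) y = t * siteDot u y := by
    intro y
    simp [siteDot, Finset.mul_sum, mul_assoc]
  simp only [density, mul_add, Finset.mul_sum]
  congr 1
  · refine Finset.sum_congr rfl fun x _ => Finset.sum_congr rfl fun α _ => ?_
    split_ifs
    · simp only [edgeTerm, Pi.smul_apply, smul_eq_mul]
      ring
    · simp
  · refine Finset.sum_congr rfl fun y _ => ?_
    simp only [jumpTerm, Pi.smul_apply, smul_eq_mul, hs]
    ring

lemma tracerFunctional_parallelogram (q : unitInterval) (u v : Fin d → ℝ) {f g : Config d → ℝ}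
    (hf : IsLocal f) (hg : IsLocal g) :
    G.tracerFunctional q (u + v) (f + g) + G.tracerFunctional q (u - v) (f - g)
      = 2 * G.tracerFunctional q u f + 2 * G.tracerFunctional q v g := by
  have hadd : IsLocal (f + g) := hf.map₂ hg (· + ·)
  have hsub : IsLocal (f - g) := hf.map₂ hg (· - ·)
  obtain ⟨S₁, h₁⟩ := G.exists_tracerFunctional_eq hadd
  obtain ⟨S₂, h₂⟩ := G.exists_tracerFunctional_eq hsub
  obtain ⟨S₃, h₃⟩ := G.exists_tracerFunctional_eq hf
  obtain ⟨S₄, h₄⟩ := G.exists_tracerFunctional_eq hg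
  set S := S₁ ∪ S₂ ∪ (S₃ ∪ S₄)
  rw [h₁ S (by grind), h₂ S (by grind), h₃ S (by grind), h₄ S (by grind),
    ← integral_add ((G.isLocal_density S _ hadd).integrable _)
      ((G.isLocal_density S _ hsub).integrable _),
    ← integral_const_mul, ← integral_const_mul,
    ← integral_add (((G.isLocal_density S _ hf).integrable _).const_mul 2)
      (((G.isLocal_density S _ hg).integrable _).const_mul 2)]
  simp only [G.density_parallelogram]

lemma tracerFunctional_smul (q : unitInterval) (t : ℝ) (u : Fin d → ℝ) {f : Config d → ℝ}
    (hf : IsLocal f) :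
    G.tracerFunctional q (t • u) (t • f) = t ^ 2 * G.tracerFunctional q u f := by
  obtain ⟨S₁, h₁⟩ := G.exists_tracerFunctional_eq hf
  obtain ⟨S₂, h₂⟩ := G.exists_tracerFunctional_eq (f := t • f) (hf.map (t * ·))
  rw [h₁ (S₁ ∪ S₂) (by grind), h₂ (S₁ ∪ S₂) (by grind), ← integral_const_mul]
  simp only [G.density_smul]

instance : Nonempty {f : Config d → ℝ // IsLocal f} := ⟨⟨_, isLocal_const 0⟩⟩

lemma bddBelow_tracerFunctional (q : unitInterval) (u : Fin d → ℝ) :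
    BddBelow (Set.range fun f : {f : Config d → ℝ // IsLocal f} => G.tracerFunctional q u f) := by
  refine ⟨0, ?_⟩
  rintro _ ⟨f, rfl⟩
  exact G.tracerFunctional_nonneg q u f

lemma selfDiffusionForm_nonneg (q : unitInterval) (u : Fin d → ℝ) :
    0 ≤ G.selfDiffusionForm q u :=
  mul_nonneg (by norm_num) (le_ciInf fun f => G.tracerFunctional_nonneg q u f)

lemma selfDiffusionForm_le (q : unitInterval) (u : Fin d → ℝ) {f : Config d → ℝ}
    (hf : IsLocal f) : G.selfDiffusionForm q u ≤ 1 / 2 * G.tracerFunctional q u f :=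
  mul_le_mul_of_nonneg_left (ciInf_le (G.bddBelow_tracerFunctional q u) ⟨f, hf⟩) (by norm_num)

lemma le_selfDiffusionForm {q : unitInterval} {u : Fin d → ℝ} {a : ℝ}
    (h : ∀ f, IsLocal f → a ≤ 1 / 2 * G.tracerFunctional q u f) :
    a ≤ G.selfDiffusionForm q u := by
  have : 2 * a ≤ ⨅ f : {f : Config d → ℝ // IsLocal f}, G.tracerFunctional q u f :=
    le_ciInf fun f => by linarith [h f f.2]
  rw [selfDiffusionForm]
  linarith

lemma selfDiffusionForm_smul_le (q : unitInterval) (t : ℝ) (u : Fin d → ℝ) :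
    G.selfDiffusionForm q (t • u) ≤ t ^ 2 * G.selfDiffusionForm q u := by
  rw [selfDiffusionForm, selfDiffusionForm, mul_left_comm, Real.mul_iInf_of_nonneg (sq_nonneg t)]
  refine mul_le_mul_of_nonneg_left (le_ciInf fun f => ?_) (by norm_num)
  rw [← G.tracerFunctional_smul q t u f.2]
  exact ciInf_le (G.bddBelow_tracerFunctional q (t • u)) ⟨t • f.1, f.2.map (t * ·)⟩

lemma selfDiffusionForm_smul (q : unitInterval) (t : ℝ) (u : Fin d → ℝ) :
    G.selfDiffusionForm q (t • u) = t ^ 2 * G.selfDiffusionForm q u := by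
  refine le_antisymm (G.selfDiffusionForm_smul_le q t u) ?_
  by_cases ht : t = 0
  · subst ht
    simpa using G.selfDiffusionForm_nonneg q _
  · have h := G.selfDiffusionForm_smul_le q t⁻¹ (t • u)
    rw [smul_smul, inv_mul_cancel₀ ht, one_smul] at h
    calc t ^ 2 * G.selfDiffusionForm q u
        ≤ t ^ 2 * (t⁻¹ ^ 2 * G.selfDiffusionForm q (t • u)) :=
          mul_le_mul_of_nonneg_left h (sq_nonneg t)
      _ = G.selfDiffusionForm q (t • u) := by field_simp

/-- For competitors `f` for `u` and `g` for `v`, the functions `f + g` and `f - g` compete for `u +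
v` and `u - v`. The infimum is then taken over `f` and `g` in turn. -/
lemma selfDiffusionForm_parallelogram_le (q : unitInterval) (u v : Fin d → ℝ) :
    G.selfDiffusionForm q (u + v) + G.selfDiffusionForm q (u - v)
      ≤ 2 * G.selfDiffusionForm q u + 2 * G.selfDiffusionForm q v := by
  have key : ∀ f g, IsLocal f → IsLocal g →
      G.selfDiffusionForm q (u + v) + G.selfDiffusionForm q (u - v)
        ≤ G.tracerFunctional q u f + G.tracerFunctional q v g := by
    intro f g hf hg
    have h := G.tracerFunctional_parallelogram q u v hf hg
    have h1 := G.selfDiffusionForm_le q (u + v) (f := f + g) (hf.map₂ hg (· + ·))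
    have h2 := G.selfDiffusionForm_le q (u - v) (f := f - g) (hf.map₂ hg (· - ·))
    linarith
  have h1 : ∀ g, IsLocal g → (G.selfDiffusionForm q (u + v) + G.selfDiffusionForm q (u - v)
      - G.tracerFunctional q v g) / 2 ≤ G.selfDiffusionForm q u := fun g hg =>
    G.le_selfDiffusionForm fun f hf => by linarith [key f g hf hg]
  have h2 : (G.selfDiffusionForm q (u + v) + G.selfDiffusionForm q (u - v)
      - 2 * G.selfDiffusionForm q u) / 2 ≤ G.selfDiffusionForm q v :=
    G.le_selfDiffusionForm fun g hg => by linarith [h1 g hg]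
  linarith

/-- The reverse inequality is the same one applied to `u + v` and `u - v`, combined with
homogeneity. -/
lemma selfDiffusionForm_parallelogram (q : unitInterval) (u v : Fin d → ℝ) :
    G.selfDiffusionForm q (u + v) + G.selfDiffusionForm q (u - v)
      = 2 * G.selfDiffusionForm q u + 2 * G.selfDiffusionForm q v := by
  refine le_antisymm (G.selfDiffusionForm_parallelogram_le q u v) ?_
  have h := G.selfDiffusionForm_parallelogram_le q (u + v) (u - v)
  have h1 : u + v + (u - v) = (2 : ℝ) • u := by module
  have h2 : u + v - (u - v) = (2 : ℝ) • v := by module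
  rw [h1, h2, selfDiffusionForm_smul, selfDiffusionForm_smul] at h
  linarith

lemma existsUnique_isSelfDiffusionMatrix (q : unitInterval) :
    ∃! D : Matrix (Fin d) (Fin d) ℝ, G.IsSelfDiffusionMatrix q D := by
  obtain ⟨D, hD, hDu⟩ := exists_matrix_of_parallelogram (G.selfDiffusionForm_nonneg q)
    (G.selfDiffusionForm_parallelogram q) (G.selfDiffusionForm_smul q)
  exact ⟨D, ⟨hD, hDu⟩, fun D' hD' => eq_of_isSymm_of_dotProduct_mulVec hD'.1 hD fun u => by
    rw [hD'.2 u, hDu u]⟩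

lemma Noncooperative.le_selfDiffusionForm (hd : 2 ≤ d) {G : LatticeGas d}
    (hG : G.Noncooperative) : ∃ (c : ℝ) (n : ℕ), 0 < c ∧ ∀ q : unitInterval, q < 1 →
      ∀ u : Fin d → ℝ, c * (q : ℝ) ^ n * (u ⬝ᵥ u) ≤ G.selfDiffusionForm q u := by
  obtain ⟨C, l, -, h⟩ := hG
  have key : ∀ α : Fin d, ∃ (n : ℕ) (K : ℝ), 0 ≤ K ∧ ∀ q : unitInterval, q < 1 →
      ∀ (u : Fin d → ℝ) (f : Config d → ℝ), IsLocal f →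
        (q : ℝ) ^ n * u α ^ 2 ≤ K * G.tracerFunctional q u f := by
    intro α
    obtain ⟨E, σ, h1, h2, h3, h4⟩ := HasMoves.exists_tracerPath hd h (basisVec_mem α)
    obtain ⟨K, hK0, hK⟩ := h1.sq_le h2 h3 h4
    have hdot : ∀ u : Fin d → ℝ, siteDot u (basisVec α) = u α := by
      intro u
      simp [siteDot, basisVec, Pi.single_apply]
    exact ⟨E.card, K, hK0, fun q hq u f hf => by simpa [hdot] using hK q hq u f hf⟩
  choose n K hK0 hK using key
  have hKsum : 0 ≤ ∑ α, K α := Finset.sum_nonneg fun α _ => hK0 α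
  -- Since `q ≤ 1`, the summed exponent serves all directions at once. The `2` comes from the factor
  -- `1 / 2` in the form, and the `+ 1` keeps the denominator positive.
  refine ⟨1 / (2 * (∑ α, K α + 1)), ∑ α, n α, by positivity, fun q hq u =>
    G.le_selfDiffusionForm fun f hf => ?_⟩
  have hQ := G.tracerFunctional_nonneg q u f
  have hsum : (q : ℝ) ^ (∑ α, n α) * (u ⬝ᵥ u) ≤ (∑ α, K α + 1) * G.tracerFunctional q u f := by
    calc (q : ℝ) ^ (∑ α, n α) * (u ⬝ᵥ u) = ∑ α, (q : ℝ) ^ (∑ α, n α) * u α ^ 2 := by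
          rw [dotProduct, Finset.mul_sum]
          simp only [sq]
      _ ≤ ∑ α, K α * G.tracerFunctional q u f := by
          refine Finset.sum_le_sum fun α _ => le_trans ?_ (hK α q hq u f hf)
          refine mul_le_mul_of_nonneg_right ?_ (sq_nonneg _)
          exact pow_le_pow_of_le_one q.2.1 q.2.2
            (Finset.single_le_sum (fun _ _ => Nat.zero_le _) (Finset.mem_univ α))
      _ ≤ (∑ α, K α + 1) * G.tracerFunctional q u f := by
          rw [← Finset.sum_mul]
          exact mul_le_mul_of_nonneg_right (by linarith) hQ
  have hpos : 0 < ∑ α, K α + 1 := by linarith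
  calc 1 / (2 * (∑ α, K α + 1)) * (q : ℝ) ^ (∑ α, n α) * (u ⬝ᵥ u)
      = ((q : ℝ) ^ (∑ α, n α) * (u ⬝ᵥ u)) / (2 * (∑ α, K α + 1)) := by ring
    _ ≤ ((∑ α, K α + 1) * G.tracerFunctional q u f) / (2 * (∑ α, K α + 1)) := by gcongr
    _ = 1 / 2 * G.tracerFunctional q u f := by field_simp

end LatticeGas

end SelfDiffusion

end KCLG

theorem mainTheorem4 {d : ℕ} (hd : 2 ≤ d) (G : KCLG.LatticeGas d) (hG : G.Noncooperative) :
    ∃ (c : ℝ) (n : ℕ), 0 < c ∧ ∀ q : unitInterval, 0 < q → q < 1 →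
      (∃! D : Matrix (Fin d) (Fin d) ℝ, G.IsSelfDiffusionMatrix q D) ∧
      ∀ D : Matrix (Fin d) (Fin d) ℝ, G.IsSelfDiffusionMatrix q D →
        D.PosDef ∧ ∀ u : Fin d → ℝ, c * (q : ℝ) ^ n * (u ⬝ᵥ u) ≤ u ⬝ᵥ D.mulVec u := by
  obtain ⟨c, n, hc, h⟩ := KCLG.LatticeGas.Noncooperative.le_selfDiffusionForm hd hG
  refine ⟨c, n, hc, fun q hq0 hq1 => ⟨G.existsUnique_isSelfDiffusionMatrix q, fun D hD => ?_⟩⟩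
  have hbound : ∀ u : Fin d → ℝ, c * (q : ℝ) ^ n * (u ⬝ᵥ u) ≤ u ⬝ᵥ D.mulVec u := fun u => by
    rw [hD.2 u]
    exact h q hq1 u
  refine ⟨Matrix.PosDef.of_dotProduct_mulVec_pos hD.1 fun u hu => ?_, hbound⟩
  have hq : (0 : ℝ) < q := by exact_mod_cast hq0
  have hu' : 0 < u ⬝ᵥ u := by
    have := Matrix.dotProduct_star_self_pos_iff.2 hu
    simpa using this
  exact lt_of_lt_of_le (by positivity) (hbound u)
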